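/- Let $L>0$, $\ell>0$, $X=L_2(0,L)$, $c\in X$ and $b_1,\dots,b_m\in L_\infty(0,L)$. Let $A=\partial_{xx}+c(\cdot)\,\mathrm{id}$ on $X$ with domain $D(A)=H^2(0,L)\cap H^1_0(0,L)$, let $(e_j)_{j\ge1}$ be a Hilbert basis of $X$ consisting of eigenfunctions of $A$, with eigenvalues $\lambda_1\ge\lambda_2\ge\cdots$, and let $n$ be the number of nonnegative eigenvalues. For $w\in X$ write $w_j=\langle w,e_j\rangle$ and $z=(w_1,\dots,w_n)^\top$, and let $X_n^\perp=\{w\in X: z=0\}$; identify $\mathbb R^n$ with $\mathrm{span}(e_1,\dots,e_n)$. Put $\mathbf A=\mathrm{diag}(\lambda_1,\dots,\lambda_n)$ and $\mathbf B=(\langle b_k,e_j\rangle)_{1\le j\le n,\,1\le k\le m}$. Let $\mathrm{sat}(r)=r$ for $|r|\le\ell$ and $\mathrm{sat}(r)=\ell r/|r|$ for $|r|\ge\ell$; it acts componentwise on vectors and pointwise on functions, $\mathrm{sat}_\infty(u)(x)=\mathrm{sat}(u(x))$. Let $\mathbf K\in\mathbb R^{m\times n}$ be such that $\mathbf A+\mathbf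 B\mathbf K$ is Hurwitz (so that the pair $(\mathbf A,\mathbf B)$ is stabilizable). Consider the three systems $$\dot z=\mathbf Az+\mathbf B\,\mathrm{sat}(\mathbf Kz)\quad\text{in }\mathbb R^n,\tag{1}$$ $$w_t=w_{xx}+c(x)w+\sum_{k=1}^m b_k(x)\,\mathrm{sat}\big((\mathbf Kz(t))_k\big),\quad w(t,0)=w(t,L)=0,\tag{2}$$ $$w_t=w_{xx}+c(x)w+\sum_{k=1}^m \mathrm{sat}_\infty\big(b_k(\cdot)(\mathbf Kz(t))_k\big)(x),\quad w(t,0)=w(t,L)=0,\tag{3}$$ where (2) and (3) are understood in the sense of mild solutions $w\in C([0,\infty);X)$; equivalently, $\frac{d}{dt}\langle\varphi,w\rangle=\langle A\varphi,w\rangle+\langle\varphi,f(w)\rangle$ on $[0,\infty)$ for all $\varphi\in D(A)$, where $f(w)$ denotes the respective input term. For each system, $\dot V$ denotes the (upper right Dini) derivative of $V$ along solutions. Let $P\in\mathbb R^{n\times n}$ be symmetric positive definite and such that, for some $\alpha_0>0$, the function $\tilde V(z)=z^\top Pz$ satisfies $\dot{\tilde V}(z)\le-\alpha_0|z|^2$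 along the solutions of (1) whenever $z^\top Pz\le1$. For $\gamma>0$ let $$V(w)=z^\top Pz+\gamma\sum_{j>n}w_j^2 .$$ Then there is $\gamma>0$ with the property (*) there is $C>0$ such that, along the solutions of (2), $\dot V(w)\le-C\|w\|^2$ whenever $z^\top Pz\le1$. Moreover, for every $\gamma>0$ with the property (*) there exist $\alpha,\beta>0$ such that, along the solutions of (3), $$\dot V(w)\le-\frac{\alpha}{2}\|w\|^2\qquad\text{whenever } z^\top Pz\le\beta .$$ In particular, $S=\{z: z^\top Pz\le\beta\}\times X_n^\perp$ is a region of attraction for (3); that is, $0$ is a Lyapunov stable fixed point of (3), $0$ is an interior point of $S$, for every initial value in $S$ a solution of (3) exists on $[0,\infty)$, and every such solution stays in $S$ and tends to $0$ in $X$ as $t\to\infty$. -/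

import Mathlib

open Set Filter Topology MeasureTheory
open scoped ENNReal Matrix

noncomputable section

namespace HeatSat

/-! ## Saturations -/

/-- The scalar saturation of level `ℓ`. -/
def sat (ℓ r : ℝ) : ℝ := if |r| ≤ ℓ then r else ℓ / |r| * r

theorem sat_eq_max_min {ℓ : ℝ} (hℓ : 0 < ℓ) (r : ℝ) : sat ℓ r = max (-ℓ) (min r ℓ) := by
  unfold sat
  split_ifs with h
  · rw [abs_le] at h
    rw [min_eq_left h.2, max_eq_right h.1]
  · push Not at h
    rcases lt_abs.1 h with h1 | h1
    · rw [abs_of_pos (hℓ.trans h1), div_mul_cancel₀ _ (hℓ.trans h1).ne', min_eq_right h1.le,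
        max_eq_right (by linarith)]
    · have hr : r < 0 := by linarith
      rw [abs_of_neg hr, min_eq_left (by linarith), max_eq_left (by linarith),
        div_neg, neg_mul, div_mul_cancel₀ _ hr.ne]

theorem lipschitzWith_sat {ℓ : ℝ} (hℓ : 0 < ℓ) : LipschitzWith 1 (sat ℓ) := by
  have h : sat ℓ = fun r => max (-ℓ) (min r ℓ) := funext (sat_eq_max_min hℓ)
  rw [h]
  exact (LipschitzWith.id.min_const ℓ).const_max (-ℓ)

theorem sat_zero {ℓ : ℝ} (hℓ : 0 < ℓ) : sat ℓ 0 = 0 := by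
  simp [sat, hℓ.le]

/-- Lebesgue measure on `(0, L)`. -/
abbrev leb (L : ℝ) : Measure ℝ := volume.restrict (Ioo 0 L)

/-- The state space `L²(0, L)` of real functions. -/
abbrev X (L : ℝ) : Type := Lp ℝ 2 (leb L)

/-- The pointwise saturation map `u ↦ (x ↦ sat (u x))` on `L²(0, L)`. -/
def satInf {ℓ : ℝ} (hℓ : 0 < ℓ) {L : ℝ} (u : X L) : X L :=
  (lipschitzWith_sat hℓ).compLp (sat_zero hℓ) u

/-! ## The operator `A = ∂ₓₓ + c` with domain `H²(0, L) ∩ H¹₀(0, L)` -/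

/-- `φ` belongs to `H²(0, L) ∩ H¹₀(0, L)` and its second weak derivative is `φ₂ ∈ L²(0, L)`:
`φ` has a representative `y` that is absolutely continuous together with its derivative `p`,
vanishes at both endpoints, and satisfies `y'' = p' = φ₂` almost everywhere. -/
def HasDirichletSecondDeriv {L : ℝ} (φ φ₂ : X L) : Prop :=
  ∃ y p : ℝ → ℝ,
    (φ : ℝ → ℝ) =ᵐ[leb L] y ∧
    AbsolutelyContinuousOnInterval y 0 L ∧
    AbsolutelyContinuousOnInterval p 0 L ∧
    (∀ᵐ x ∂(leb L), HasDerivAt y (p x) x) ∧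
    (∀ᵐ x ∂(leb L), HasDerivAt p (φ₂ x) x) ∧
    y 0 = 0 ∧ y L = 0

/-- The graph of `A`: `φ ∈ D(A)` and `A φ = φ'' + c φ = ψ`. -/
def IsOp {L : ℝ} (c φ ψ : X L) : Prop :=
  ∃ φ₂ : X L, HasDirichletSecondDeriv φ φ₂ ∧
    (ψ : ℝ → ℝ) =ᵐ[leb L] fun x => φ₂ x + c x * φ x

/-- `w` is a (mild, equivalently weak) solution on `[0, ∞)` of the abstract Cauchy problem
`w' = A w + F (w)` in `L²(0, L)`: it is continuous with values in `L²(0, L)` and, for every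
`φ ∈ D(A)`, one has `d/dt ⟨φ, w⟩ = ⟨A φ, w⟩ + ⟨φ, F (w)⟩` (the operator `A` is selfadjoint). -/
def IsSolution {L : ℝ} (c : X L) (F : X L → X L) (w : ℝ → X L) : Prop :=
  ContinuousOn w (Ici 0) ∧
    ∀ φ ψ : X L, IsOp c φ ψ → ∀ t : ℝ, 0 ≤ t →
      HasDerivWithinAt (fun s => inner ℝ φ (w s))
        (inner ℝ ψ (w t) + inner ℝ φ (F (w t))) (Ici 0) t

/-! ## Modal coordinates, feedback, closed-loop systems -/

section Modal

variable {L : ℝ} {m : ℕ}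

/-- The first `n` coordinates `z = (w₁, …, w_n)` of `w` in the Hilbert basis `e`. -/
def modes (e : HilbertBasis ℕ ℝ (X L)) (n : ℕ) (w : X L) : EuclideanSpace ℝ (Fin n) :=
  WithLp.toLp 2 fun j => inner ℝ (e j) w

/-- The matrix `𝐀 = diag (λ₁, …, λ_n)`. -/
def matA (lam : ℕ → ℝ) (n : ℕ) : Matrix (Fin n) (Fin n) ℝ :=
  Matrix.diagonal fun j => lam j

/-- The matrix `𝐁` with entries `⟨b_k, e_j⟩`. -/
def matB (e : HilbertBasis ℕ ℝ (X L)) (b : Fin m → X L) (n : ℕ) :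
    Matrix (Fin n) (Fin m) ℝ :=
  Matrix.of fun j k => inner ℝ (b k) (e j)

/-- A real square matrix is Hurwitz if all its complex eigenvalues have negative real part. -/
def IsHurwitz {n : ℕ} (M : Matrix (Fin n) (Fin n) ℝ) : Prop :=
  ∀ μ ∈ spectrum ℂ (M.map (algebraMap ℝ ℂ)), μ.re < 0

/-- `z` solves the finite-dimensional saturated system `z' = 𝐀 z + 𝐁 sat (𝐊 z)` on `[0, ∞)`. -/
def IsFinSolution {n : ℕ} (ℓ : ℝ) (A : Matrix (Fin n) (Fin n) ℝ) (B : Matrix (Fin n) (Fin m) ℝ)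
    (K : Matrix (Fin m) (Fin n) ℝ) (z : ℝ → EuclideanSpace ℝ (Fin n)) : Prop :=
  ∀ t : ℝ, 0 ≤ t →
    HasDerivWithinAt z
      (WithLp.toLp 2 (A *ᵥ (z t).ofLp + B *ᵥ fun k => sat ℓ ((K *ᵥ (z t).ofLp) k)))
      (Ici 0) t

/-- The feedback input with componentwise saturation, `w ↦ ∑ₖ sat ((𝐊 z)ₖ) bₖ`. -/
def componentwiseInput {n : ℕ} (ℓ : ℝ) (e : HilbertBasis ℕ ℝ (X L)) (b : Fin m → X L)
    (K : Matrix (Fin m) (Fin n) ℝ) (w : X L) : X L :=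
  ∑ k, sat ℓ ((K *ᵥ (modes e n w).ofLp) k) • b k

/-- The feedback input with pointwise saturation, `w ↦ ∑ₖ sat_∞ (bₖ(·) (𝐊 z)ₖ)`. -/
def pointwiseInput {n : ℕ} {ℓ : ℝ} (hℓ : 0 < ℓ) (e : HilbertBasis ℕ ℝ (X L)) (b : Fin m → X L)
    (K : Matrix (Fin m) (Fin n) ℝ) (w : X L) : X L :=
  ∑ k, satInf hℓ ((K *ᵥ (modes e n w).ofLp) k • b k)

/-- The quadratic form `zᵀ P z`. -/
def quad {n : ℕ} (P : Matrix (Fin n) (Fin n) ℝ) (z : EuclideanSpace ℝ (Fin n)) : ℝ :=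
  z.ofLp ⬝ᵥ (P *ᵥ z.ofLp)

/-- The Lyapunov function `V (w) = zᵀ P z + γ ∑_{j > n} w_j²`. -/
def lyap {n : ℕ} (e : HilbertBasis ℕ ℝ (X L)) (P : Matrix (Fin n) (Fin n) ℝ) (γ : ℝ)
    (w : X L) : ℝ :=
  quad P (modes e n w) + γ * ∑' j : ℕ, (inner ℝ (e (n + j)) w) ^ 2

end Modal

/-! ## Derivatives along solutions, regions of attraction -/

/-- The upper right Dini derivative of `g` at `t`, an extended real number. -/
def diniUpper (g : ℝ → ℝ) (t : ℝ) : EReal :=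
  limsup (fun h : ℝ => (((g (t + h) - g t) / h : ℝ) : EReal)) (𝓝[>] 0)

/-- For the system whose solutions are the curves satisfying `Sol`, the derivative of `V` along
solutions satisfies `V̇ ≤ -a |w|²` whenever the state `w` is in `S`. -/
def DecaysOn {E : Type*} [NormedAddCommGroup E] (Sol : (ℝ → E) → Prop) (V : E → ℝ) (S : Set E)
    (a : ℝ) : Prop :=
  ∀ w : ℝ → E, Sol w → ∀ t : ℝ, 0 ≤ t → w t ∈ S →
    diniUpper (fun s => V (w s)) t ≤ ((-a * ‖w t‖ ^ 2 : ℝ) : EReal)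

/-- `S` is a region of attraction of the Lyapunov stable fixed point `0` of the system whose
solutions on `[0, ∞)` are the curves satisfying `Sol`. -/
structure IsRegionOfAttraction {E : Type*} [NormedAddCommGroup E] (Sol : (ℝ → E) → Prop)
    (S : Set E) : Prop where
  fixed_point : Sol fun _ => 0
  stable : ∀ ε : ℝ, 0 < ε → ∃ δ : ℝ, 0 < δ ∧
    ∀ w, Sol w → ‖w 0‖ < δ → ∀ t : ℝ, 0 ≤ t → ‖w t‖ < ε
  zero_mem_interior : (0 : E) ∈ interior S
  exists_solution : ∀ w₀ ∈ S, ∃ w, Sol w ∧ w 0 = w₀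
  attractive : ∀ w, Sol w → w 0 ∈ S → Tendsto w atTop (𝓝 0)
  invariant : ∀ w, Sol w → w 0 ∈ S → ∀ t : ℝ, 0 ≤ t → w t ∈ S

end HeatSat

end

/-!
The coordinates `w_j = ⟨w, e_j⟩` of a solution of `w' = A w + F (w)` satisfy
`w_j' = lam_j w_j + ⟨e_j, F (w)⟩`, and `lam_j ≤ lam_n < 0` for `j ≥ n`. No compactness of the resolvent
is needed: the sign of `lam_n` and monotonicity provide all the dissipation.

*Weights.* The energy of the modes `j ≥ N` satisfies
`D⁺ ‖tail‖² ≤ 2 (lam_N ‖tail‖² + ⟨tail, F (w)⟩)` (`eventually_tail_energy_le`), by passing to the limit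
in finitely many modes. With componentwise saturation, `z` solves the finite-dimensional system by
itself, so `zᵀ P z` decays by assumption, and the input is bounded by a multiple of `‖z‖`. Young's
inequality then absorbs the coupling if `γ` is small (`exists_weight`).

*Transfer.* As the profiles are bounded, both saturations are inactive where `z` is small, and there
the two inputs coincide (`exists_pointwiseInput_eq`). The decay along solutions of the componentwise
system is turned into an inequality between functions of the state alone
(`headDeriv_le_of_decaysOn`): at a state with finitely many nonzero modes, the Dini derivative is at
least the derivative of the part of `V` that involves these modes. For a solution of the pointwise
saturated system, this inequality is applied to the truncations of its state; the remaining modes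
contribute an error that tends to zero with the order of truncation (`decaysOn_pointwiseInput`). The
rate `α / 2` is the constant `C` of the componentwise system.

*Attraction.* On the boundary of the ellipsoid `zᵀ P z` decreases strictly, so the ellipsoid is
invariant (`quad_le_of_quad_zero_le`), and a comparison principle for Dini derivatives makes `V`,
which is equivalent to `‖w‖²`, decay exponentially (`isRegionOfAttraction_of_decaysOn`). Solutions
exist for every initial value because the inputs are globally Lipschitz: the Duhamel equation for the
diagonal semigroup is solved by Banach's fixed point theorem in an exponentially weighted space
(`exists_duhamel_solution`), and it implies the weak equation because `A` is symmetric
(`IsOp.inner_comm`).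
-/

noncomputable section

namespace HeatSat

section Hilbert

variable {H : Type*} [NormedAddCommGroup H] [InnerProductSpace ℝ H]

/-! ### Truncation in a Hilbert basis -/

/-- The orthogonal projection of `H` onto the span of the first `N` vectors of the Hilbert
basis `e`. -/
def truncation (e : HilbertBasis ℕ ℝ H) (N : ℕ) : H →L[ℝ] H :=
  ∑ j ∈ Finset.range N, (innerSL ℝ (e j)).smulRight (e j)

theorem truncation_apply (e : HilbertBasis ℕ ℝ H) (N : ℕ) (w : H) :
    truncation e N w = ∑ j ∈ Finset.range N, inner ℝ (e j) w • e j := by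
  simp [truncation]

theorem inner_basis_truncation (e : HilbertBasis ℕ ℝ H) (N j : ℕ) (w : H) :
    inner ℝ (e j) (truncation e N w) = if j < N then inner ℝ (e j) w else 0 := by
  simp [truncation_apply, inner_sum, inner_smul_right, orthonormal_iff_ite.1 e.orthonormal]

theorem inner_truncation_left (e : HilbertBasis ℕ ℝ H) (N : ℕ) (w f : H) :
    inner ℝ (truncation e N w) f
      = ∑ j ∈ Finset.range N, inner ℝ (e j) w * inner ℝ (e j) f := by
  simp [truncation_apply, sum_inner, inner_smul_left]

theorem inner_truncation_comm (e : HilbertBasis ℕ ℝ H) (N : ℕ) (w f : H) :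
    inner ℝ (truncation e N w) f = inner ℝ w (truncation e N f) := by
  rw [real_inner_comm _ w, inner_truncation_left, inner_truncation_left]
  exact Finset.sum_congr rfl fun j _ => mul_comm _ _

theorem truncation_truncation (e : HilbertBasis ℕ ℝ H) (N : ℕ) (w : H) :
    truncation e N (truncation e N w) = truncation e N w := by
  rw [truncation_apply e N (truncation e N w), truncation_apply]
  refine Finset.sum_congr rfl fun j hj => ?_
  rw [← truncation_apply, inner_basis_truncation, if_pos (Finset.mem_range.1 hj)]

theorem norm_sq_truncation (e : HilbertBasis ℕ ℝ H) (N : ℕ) (w : H) :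
    ‖truncation e N w‖ ^ 2 = ∑ j ∈ Finset.range N, inner ℝ (e j) w ^ 2 := by
  rw [← real_inner_self_eq_norm_sq, inner_truncation_comm, truncation_truncation,
    real_inner_comm, inner_truncation_left]
  exact Finset.sum_congr rfl fun j _ => (sq _).symm

theorem norm_sq_eq_truncation_add (e : HilbertBasis ℕ ℝ H) (N : ℕ) (w : H) :
    ‖w‖ ^ 2 = ‖truncation e N w‖ ^ 2 + ‖w - truncation e N w‖ ^ 2 := by
  have h : inner ℝ (truncation e N w) (w - truncation e N w) = 0 := by
    rw [inner_truncation_comm, map_sub, truncation_truncation, sub_self, inner_zero_right]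
  have := norm_add_sq_real (truncation e N w) (w - truncation e N w)
  rw [h, add_sub_cancel] at this
  linarith

theorem norm_truncation_le (e : HilbertBasis ℕ ℝ H) (N : ℕ) (w : H) :
    ‖truncation e N w‖ ≤ ‖w‖ := by
  have := norm_sq_eq_truncation_add e N w
  exact le_of_sq_le_sq (by nlinarith [sq_nonneg ‖w - truncation e N w‖]) (norm_nonneg _)

theorem norm_sub_truncation_le (e : HilbertBasis ℕ ℝ H) (N : ℕ) (w : H) :
    ‖w - truncation e N w‖ ≤ ‖w‖ := by
  have := norm_sq_eq_truncation_add e N w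
  exact le_of_sq_le_sq (by nlinarith [sq_nonneg ‖truncation e N w‖]) (norm_nonneg _)

theorem tendsto_truncation (e : HilbertBasis ℕ ℝ H) (w : H) :
    Tendsto (fun N => truncation e N w) atTop (𝓝 w) := by
  have h := (e.hasSum_repr w).tendsto_sum_nat
  simpa only [truncation_apply, HilbertBasis.repr_apply_apply] using h

theorem ext_inner_basis (e : HilbertBasis ℕ ℝ H) {x y : H}
    (h : ∀ j, inner ℝ (e j) x = inner ℝ (e j) y) : x = y := by
  apply e.repr.injective
  ext j
  simpa only [HilbertBasis.repr_apply_apply] using h j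

theorem hasSum_sq_inner_basis (e : HilbertBasis ℕ ℝ H) (w : H) :
    HasSum (fun j => inner ℝ (e j) w ^ 2) (‖w‖ ^ 2) := by
  have h := e.hasSum_inner_mul_inner w w
  rw [real_inner_self_eq_norm_sq] at h
  simpa only [real_inner_comm w, sq] using h

/-- Parseval's identity for the coordinates from the index `n` on. -/
theorem tsum_sq_inner_basis_add (e : HilbertBasis ℕ ℝ H) (n : ℕ) (w : H) :
    ∑' j, inner ℝ (e (n + j)) w ^ 2 = ‖w - truncation e n w‖ ^ 2 := by
  have h := hasSum_sq_inner_basis e w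
  have h1 := h.summable.sum_add_tsum_nat_add n
  rw [h.tsum_eq, norm_sq_eq_truncation_add e n w, norm_sq_truncation] at h1
  simp_rw [add_comm n]
  linarith

/-! ### Diagonal operators and the semigroup they generate -/

theorem exists_diagonal (e : HilbertBasis ℕ ℝ H) {a : ℕ → ℝ} {M : ℝ} (hM : 0 ≤ M)
    (ha : ∀ j, |a j| ≤ M) :
    ∃ T : H →L[ℝ] H, (∀ j x, inner ℝ (e j) (T x) = a j * inner ℝ (e j) x) ∧
      ∀ x, ‖T x‖ ≤ M * ‖x‖ := by
  have hle : ∀ x j, (a j * inner ℝ (e j) x) ^ 2 ≤ M ^ 2 * inner ℝ (e j) x ^ 2 := by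
    intro x j
    rw [mul_pow]
    exact mul_le_mul_of_nonneg_right (sq_le_sq.2 ((ha j).trans (le_abs_self M))) (sq_nonneg _)
  have hsum : ∀ x, Summable fun j => (a j * inner ℝ (e j) x) ^ 2 := fun x =>
    Summable.of_nonneg_of_le (fun j => sq_nonneg _) (hle x)
      ((hasSum_sq_inner_basis e x).summable.mul_left _)
  have hmem : ∀ x, Memℓp (fun j => a j * inner ℝ (e j) x) 2 := fun x => by
    refine memℓp_gen ?_
    simpa [mul_pow] using hsum x
  let f : H → H := fun x => e.repr.symm ⟨_, hmem x⟩
  have hf : ∀ j x, inner ℝ (e j) (f x) = a j * inner ℝ (e j) x := by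
    intro j x
    rw [← HilbertBasis.repr_apply_apply]
    simp [f]
  let T : H →ₗ[ℝ] H :=
    { toFun := f
      map_add' := fun x y => ext_inner_basis e fun j => by
        rw [inner_add_right, hf, hf, hf, inner_add_right, mul_add]
      map_smul' := fun r x => ext_inner_basis e fun j => by
        simp only [inner_smul_right, hf, RingHom.id_apply]
        ring }
  have hb : ∀ x, ‖T x‖ ≤ M * ‖x‖ := by
    intro x
    refine le_of_sq_le_sq ?_ (by positivity)
    have h1 := hasSum_sq_inner_basis e (T x)
    have h2 := (hasSum_sq_inner_basis e x).mul_left (M ^ 2)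
    rw [mul_pow]
    refine hasSum_le (fun j => ?_) h1 h2
    have : inner ℝ (e j) (T x) = a j * inner ℝ (e j) x := hf j x
    rw [this]
    exact hle x j
  exact ⟨T.mkContinuous M hb, hf, hb⟩

/-- The semigroup `S t = diag (exp (lam j * t))`, extended by `S t = id` to
negative times. -/
theorem exists_diagonal_semigroup (e : HilbertBasis ℕ ℝ H) {lam : ℕ → ℝ} {ω : ℝ} (hω : 0 ≤ ω)
    (hlam : ∀ j, lam j ≤ ω) :
    ∃ S : ℝ → H →L[ℝ] H,
      (∀ t j x, inner ℝ (e j) (S t x) = Real.exp (lam j * max t 0) * inner ℝ (e j) x) ∧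
      (∀ t x, ‖S t x‖ ≤ Real.exp (ω * max t 0) * ‖x‖) ∧
      Continuous fun p : ℝ × H => S p.1 p.2 := by
  have h : ∀ t : ℝ, ∃ T : H →L[ℝ] H,
      (∀ j x, inner ℝ (e j) (T x) = Real.exp (lam j * max t 0) * inner ℝ (e j) x) ∧
      ∀ x, ‖T x‖ ≤ Real.exp (ω * max t 0) * ‖x‖ := fun t => by
    refine exists_diagonal e (Real.exp_pos _).le fun j => ?_
    rw [Real.abs_exp]
    exact Real.exp_le_exp.2 (mul_le_mul_of_nonneg_right (hlam j) (le_max_right _ _))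
  choose S hS hSn using h
  refine ⟨S, hS, hSn, ?_⟩
  -- the truncations of `S t x` depend continuously on `(t, x)`, locally uniformly close to `S t x`
  refine continuous_of_locally_uniform_approx_of_continuousAt fun p u hu => ?_
  obtain ⟨t₀, x₀⟩ := p
  obtain ⟨ε, hε, hεu⟩ := Metric.mem_uniformity_dist.1 hu
  set M : ℝ := Real.exp (ω * max (t₀ + 1) 0) with hMdef
  have hM : 0 < M := Real.exp_pos _
  have htr := tendsto_truncation e x₀
  obtain ⟨N, hN⟩ := (Metric.tendsto_atTop.1 htr (ε / (2 * M)) (by positivity))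
  have hN := hN N le_rfl
  rw [dist_comm, dist_eq_norm] at hN
  refine ⟨Iio (t₀ + 1) ×ˢ Metric.ball x₀ (ε / (2 * M)), prod_mem_nhds (Iio_mem_nhds (by linarith))
    (Metric.ball_mem_nhds _ (by positivity)), fun p => ∑ j ∈ Finset.range N,
      (Real.exp (lam j * max p.1 0) * inner ℝ (e j) p.2) • e j, ?_, ?_⟩
  · exact Continuous.continuousAt (by fun_prop)
  · rintro ⟨t, x⟩ ⟨ht, hx⟩
    apply hεu
    have h1 : ∑ j ∈ Finset.range N, (Real.exp (lam j * max t 0) * inner ℝ (e j) x) • e j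
        = S t (truncation e N x) := by
      apply ext_inner_basis e
      intro i
      rw [hS, inner_basis_truncation]
      simp [inner_sum, inner_smul_right, orthonormal_iff_ite.1 e.orthonormal]
    have h2 : ‖x - truncation e N x‖ < ε / M := by
      have h3 : x - truncation e N x
          = (x₀ - truncation e N x₀) + ((x - x₀) - truncation e N (x - x₀)) := by
        rw [map_sub]; abel
      have h4 := norm_sub_truncation_le e N (x - x₀)
      rw [Metric.mem_ball, dist_eq_norm] at hx
      rw [h3]
      calc _ ≤ _ := norm_add_le _ _
        _ < ε / (2 * M) + ε / (2 * M) := by linarith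
        _ = ε / M := by field_simp; ring
    dsimp only
    rw [h1, dist_eq_norm, ← map_sub]
    calc _ ≤ _ := hSn t _
      _ ≤ M * ‖x - truncation e N x‖ := by
        refine mul_le_mul_of_nonneg_right (Real.exp_le_exp.2 ?_) (norm_nonneg _)
        exact mul_le_mul_of_nonneg_left (max_le_max_right 0 (le_of_lt ht)) hω
      _ < M * (ε / M) := by gcongr
      _ = ε := by field_simp

end Hilbert

section Existence

variable {H : Type*} [NormedAddCommGroup H] [InnerProductSpace ℝ H]

/-! ### Global mild solutions for Lipschitz inputs -/

theorem continuous_of_norm_sub_le {E : Type*} [NormedAddCommGroup E] {F : E → E} {κ : ℝ}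
    (hF : ∀ x y, ‖F x - F y‖ ≤ κ * ‖x - y‖) : Continuous F :=
  (LipschitzWith.of_dist_le' fun x y => by simpa only [dist_eq_norm] using hF x y).continuous

/-- The estimate that makes the Duhamel map a contraction for the weighted norm
`sup ‖exp (-(ω + 2 K) t) w t‖`. -/
theorem norm_duhamel_le {S : ℝ → H →L[ℝ] H} {ω K d : ℝ} (hd : 0 ≤ d)
    (hS : ∀ t x, ‖S t x‖ ≤ Real.exp (ω * max t 0) * ‖x‖) {g : ℝ → H} {t : ℝ} (ht : 0 ≤ t)
    (hg : ∀ s, ‖g s‖ ≤ K * (Real.exp ((ω + 2 * K) * s) * d)) :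
    ‖∫ s in (0 : ℝ)..t, S (t - s) (g s)‖ ≤ Real.exp ((ω + 2 * K) * t) * (d / 2) := by
  have hint : IntervalIntegrable
      (fun s => d / 2 * Real.exp (ω * t) * (Real.exp (2 * K * s) * (2 * K))) volume 0 t :=
    Continuous.intervalIntegrable (by fun_prop) _ _
  have hle := intervalIntegral.norm_integral_le_of_norm_le (μ := volume)
    (f := fun s => S (t - s) (g s)) ht (ae_of_all _ fun s hs => ?_) hint
  · refine hle.trans ?_
    have hder : ∀ s ∈ uIcc 0 t, HasDerivAt
        (fun s => d / 2 * Real.exp (ω * t) * Real.exp (2 * K * s))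
        (d / 2 * Real.exp (ω * t) * (Real.exp (2 * K * s) * (2 * K))) s := fun s _ => by
      have h := ((hasDerivAt_id s).const_mul (2 * K)).exp.const_mul (d / 2 * Real.exp (ω * t))
      simpa using h
    rw [intervalIntegral.integral_eq_sub_of_hasDerivAt hder hint, add_mul, Real.exp_add]
    have : 0 ≤ d / 2 * Real.exp (ω * t) * Real.exp (2 * K * 0) := by positivity
    linarith
  · have hts : max (t - s) 0 = t - s := max_eq_left (by linarith [hs.2])
    calc ‖S (t - s) (g s)‖ ≤ Real.exp (ω * (t - s)) * ‖g s‖ := by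
          have := hS (t - s) (g s)
          rwa [hts] at this
      _ ≤ Real.exp (ω * (t - s)) * (K * (Real.exp ((ω + 2 * K) * s) * d)) := by
          gcongr
          exact hg s
      _ = d / 2 * Real.exp (ω * t) * (Real.exp (2 * K * s) * (2 * K)) := by
          have : Real.exp (ω * (t - s)) * Real.exp ((ω + 2 * K) * s)
              = Real.exp (ω * t) * Real.exp (2 * K * s) := by
            rw [← Real.exp_add, ← Real.exp_add]
            ring_nf
          linear_combination (K * d) * this

/-- The Duhamel equation with a globally Lipschitz input is solvable for all times, by Banach's
fixed point theorem in the space of bounded continuous functions `t ↦ exp (-Λ t) w t`. -/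
theorem exists_duhamel_solution [CompleteSpace H] {S : ℝ → H →L[ℝ] H} {ω K : ℝ} (hK : 0 < K)
    (hω : 0 ≤ ω) (hS : ∀ t x, ‖S t x‖ ≤ Real.exp (ω * max t 0) * ‖x‖)
    (hSc : Continuous fun p : ℝ × H => S p.1 p.2) {F : H → H} (hF0 : F 0 = 0)
    (hF : ∀ x y, ‖F x - F y‖ ≤ K * ‖x - y‖) (w₀ : H) :
    ∃ w : ℝ → H, Continuous w ∧
      ∀ t, 0 ≤ t → w t = S t w₀ + ∫ s in (0 : ℝ)..t, S (t - s) (F (w s)) := by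
  set Λ : ℝ := ω + 2 * K with hΛ
  have hΛ0 : 0 ≤ Λ := by positivity
  have hFc : Continuous F := continuous_of_norm_sub_le hF
  let E := BoundedContinuousFunction ℝ H
  let I : E → ℝ → H := fun u t =>
    ∫ s in (0 : ℝ)..t, S (t - s) (F (Real.exp (Λ * s) • u s))
  have hgc : ∀ u : E, Continuous fun s => F (Real.exp (Λ * s) • u s) := fun u =>
    hFc.comp (by fun_prop)
  have hpc : ∀ u : E, Continuous fun p : ℝ × ℝ =>
      S (p.1 - p.2) (F (Real.exp (Λ * p.2) • u p.2)) := fun u =>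
    hSc.comp ((continuous_fst.sub continuous_snd).prodMk ((hgc u).comp continuous_snd))
  have hIc : ∀ u : E, Continuous (I u) := fun u =>
    intervalIntegral.continuous_parametric_intervalIntegral_of_continuous (hpc u) continuous_id
  have hint : ∀ (u : E) (t : ℝ), IntervalIntegrable
      (fun s => S (t - s) (F (Real.exp (Λ * s) • u s))) volume 0 t := fun u t =>
    ((hpc u).comp (continuous_const.prodMk continuous_id)).intervalIntegrable _ _
  have hdiff : ∀ (u v : E) (t : ℝ), 0 ≤ t →
      ‖I u t - I v t‖ ≤ Real.exp (Λ * t) * (dist u v / 2) := by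
    intro u v t ht
    have h1 : I u t - I v t = ∫ s in (0 : ℝ)..t, S (t - s)
        (F (Real.exp (Λ * s) • u s) - F (Real.exp (Λ * s) • v s)) := by
      rw [← intervalIntegral.integral_sub (hint u t) (hint v t)]
      simp only [map_sub]
    rw [h1]
    refine norm_duhamel_le dist_nonneg hS ht fun s => (hF _ _).trans ?_
    rw [← smul_sub, norm_smul, Real.norm_of_nonneg (Real.exp_pos _).le, ← dist_eq_norm]
    gcongr
    exact BoundedContinuousFunction.dist_coe_le_dist s
  have hI0 : ∀ t, I 0 t = 0 := fun t => by
    have h0 : ∀ s, (0 : E) s = 0 := fun _ => rfl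
    simp [I, hF0, h0]
  let Φ₀ : E → ℝ → H := fun u t =>
    Real.exp (-(Λ * max t 0)) • (S (max t 0) w₀ + I u (max t 0))
  have hΦc : ∀ u, Continuous (Φ₀ u) := fun u => by
    have h1 : Continuous fun t : ℝ => S (max t 0) w₀ :=
      hSc.comp ((continuous_id.max continuous_const).prodMk continuous_const)
    have h2 : Continuous fun t : ℝ => I u (max t 0) :=
      (hIc u).comp (continuous_id.max continuous_const)
    exact Continuous.smul (by fun_prop) (h1.add h2)
  have hΦb : ∀ u t, ‖Φ₀ u t‖ ≤ ‖w₀‖ + dist u 0 / 2 := by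
    intro u t
    have ht : 0 ≤ max t 0 := le_max_right _ _
    have h1 := hdiff u 0 _ ht
    rw [hI0, sub_zero] at h1
    have h2 : ‖S (max t 0) w₀‖ ≤ Real.exp (Λ * max t 0) * ‖w₀‖ := by
      refine (hS _ _).trans ?_
      rw [max_eq_left ht]
      gcongr
      linarith
    rw [norm_smul, Real.norm_of_nonneg (Real.exp_pos _).le, Real.exp_neg,
      inv_mul_le_iff₀ (Real.exp_pos _)]
    exact (norm_add_le _ _).trans (by linarith)
  let Φ : E → E := fun u => BoundedContinuousFunction.ofNormedAddCommGroup (Φ₀ u) (hΦc u) _ (hΦb u)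
  have hΦ : ContractingWith (1 / 2) Φ := by
    refine ⟨by norm_num, LipschitzWith.of_dist_le_mul fun u v => ?_⟩
    rw [BoundedContinuousFunction.dist_le (by positivity)]
    intro t
    have h : Φ u t - Φ v t
        = Real.exp (-(Λ * max t 0)) • (I u (max t 0) - I v (max t 0)) := by
      change Φ₀ u t - Φ₀ v t = _
      simp only [Φ₀]
      rw [← smul_sub, add_sub_add_left_eq_sub]
    rw [dist_eq_norm, h, norm_smul, Real.norm_of_nonneg (Real.exp_pos _).le, Real.exp_neg,
      inv_mul_le_iff₀ (Real.exp_pos _)]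
    refine (hdiff u v _ (le_max_right _ _)).trans (le_of_eq ?_)
    push_cast
    ring
  set u : E := hΦ.fixedPoint
  have hu : Φ u = u := hΦ.fixedPoint_isFixedPt
  refine ⟨fun t => Real.exp (Λ * t) • u t, by fun_prop, fun t ht => ?_⟩
  have h1 : u t = Φ₀ u t := congrArg (fun v : E => v t) hu.symm
  simp only [Φ₀, max_eq_left ht] at h1
  dsimp only
  rw [h1, smul_smul, ← Real.exp_add, add_neg_cancel, Real.exp_zero, one_smul]

/-- The coordinates of the Duhamel solution satisfy the modal equations. -/
theorem exists_modal_solution [CompleteSpace H] (e : HilbertBasis ℕ ℝ H) {lam : ℕ → ℝ} {ω K : ℝ}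
    (hlam : ∀ j, lam j ≤ ω) {F : H → H} (hF0 : F 0 = 0)
    (hF : ∀ x y, ‖F x - F y‖ ≤ K * ‖x - y‖) (w₀ : H) :
    ∃ w : ℝ → H, Continuous w ∧ w 0 = w₀ ∧ ∀ j t, 0 ≤ t →
      HasDerivWithinAt (fun s => inner ℝ (e j) (w s))
        (lam j * inner ℝ (e j) (w t) + inner ℝ (e j) (F (w t))) (Ici 0) t := by
  obtain ⟨S, hSj, hSn, hSc⟩ := exists_diagonal_semigroup e (le_max_right ω 0)
    fun j => (hlam j).trans (le_max_left ω 0)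
  have hF' : ∀ x y, ‖F x - F y‖ ≤ max K 1 * ‖x - y‖ := fun x y =>
    (hF x y).trans (mul_le_mul_of_nonneg_right (le_max_left _ _) (norm_nonneg _))
  obtain ⟨w, hwc, hw⟩ := exists_duhamel_solution (K := max K 1) (by positivity)
    (le_max_right ω 0) hSn hSc hF0 hF' w₀
  have hFc : Continuous F := continuous_of_norm_sub_le hF
  refine ⟨w, hwc, ?_, fun j t ht => ?_⟩
  · rw [hw 0 le_rfl, intervalIntegral.integral_same, add_zero]
    exact ext_inner_basis e fun j => by simp [hSj]
  · set G : ℝ → ℝ := fun s => Real.exp (-(lam j * s)) * inner ℝ (e j) (F (w s)) with hG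
    have hGc : Continuous G := by fun_prop
    have hform : ∀ s, 0 ≤ s → inner ℝ (e j) (w s)
        = Real.exp (lam j * s) * (inner ℝ (e j) w₀ + ∫ r in (0 : ℝ)..s, G r) := by
      intro s hs
      have hint : IntervalIntegrable (fun r => S (s - r) (F (w r))) volume 0 s :=
        (hSc.comp ((continuous_const.sub continuous_id).prodMk
          (hFc.comp hwc))).intervalIntegrable _ _
      have h1 : inner ℝ (e j) (∫ r in (0 : ℝ)..s, S (s - r) (F (w r)))
          = ∫ r in (0 : ℝ)..s, inner ℝ (e j) (S (s - r) (F (w r))) :=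
        ((innerSL ℝ (e j)).intervalIntegral_comp_comm hint).symm
      rw [hw s hs, inner_add_right, h1, hSj, max_eq_left hs, mul_add,
        ← intervalIntegral.integral_const_mul]
      congr 1
      refine intervalIntegral.integral_congr fun r hr => ?_
      rw [uIcc_of_le hs] at hr
      simp only [hG]
      rw [hSj, max_eq_left (by linarith [hr.2]), ← mul_assoc, ← Real.exp_add]
      ring_nf
    have hd1 : HasDerivAt (fun s => ∫ r in (0 : ℝ)..s, G r) (G t) t :=
      (hGc.integral_hasStrictDerivAt 0 t).hasDerivAt
    have hd2 : HasDerivAt (fun s => Real.exp (lam j * s)) (Real.exp (lam j * t) * lam j) t := by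
      simpa using ((hasDerivAt_id t).const_mul (lam j)).exp
    have hd := hd2.mul (hd1.const_add (inner ℝ (e j) w₀))
    refine (hd.hasDerivWithinAt (s := Ici 0)).congr_deriv ?_ |>.congr hform (hform t ht)
    have : Real.exp (lam j * t) * G t = inner ℝ (e j) (F (w t)) := by
      simp only [hG]
      rw [← mul_assoc, ← Real.exp_add, add_neg_cancel, Real.exp_zero, one_mul]
    rw [this, hform t ht]
    ring

/-- The modal equations imply the weak equation tested against any `φ` in the maximal domain
`{φ | ∑ (lam j * φ j)² < ∞}` of the diagonal operator: integrate the equation tested against the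
truncations of `φ` and pass to the limit. -/
theorem hasDerivWithinAt_inner_of_modal (e : HilbertBasis ℕ ℝ H) {lam : ℕ → ℝ} {w f : ℝ → H}
    (hw : Continuous w) (hf : Continuous f)
    (hmodal : ∀ j t, 0 ≤ t → HasDerivWithinAt (fun s => inner ℝ (e j) (w s))
        (lam j * inner ℝ (e j) (w t) + inner ℝ (e j) (f t)) (Ici 0) t)
    {φ ψ : H} (hφ : ∀ j, inner ℝ (e j) ψ = lam j * inner ℝ (e j) φ) {t : ℝ} (ht : 0 ≤ t) :
    HasDerivWithinAt (fun s => inner ℝ φ (w s)) (inner ℝ ψ (w t) + inner ℝ φ (f t)) (Ici 0) t := by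
  set h : ℝ → ℝ := fun s => inner ℝ ψ (w s) + inner ℝ φ (f s)
  have hhc : Continuous h := by fun_prop
  have hform : ∀ s, 0 ≤ s → inner ℝ φ (w s) = inner ℝ φ (w 0) + ∫ r in (0 : ℝ)..s, h r := by
    intro s hs
    have hN : ∀ N, ∫ r in (0 : ℝ)..s,
        (inner ℝ (truncation e N ψ) (w r) + inner ℝ (truncation e N φ) (f r))
        = inner ℝ (truncation e N φ) (w s) - inner ℝ (truncation e N φ) (w 0) := by
      intro N
      refine intervalIntegral.integral_eq_sub_of_hasDeriv_right_of_le hs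
        (f := fun r => inner ℝ (truncation e N φ) (w r)) (by fun_prop) (fun r hr => ?_)
        (Continuous.intervalIntegrable (by fun_prop) _ _)
      simp only [inner_truncation_left, ← Finset.sum_add_distrib]
      refine HasDerivWithinAt.fun_sum fun j _ => ?_
      refine (((hmodal j r hr.1.le).mono
        ((Ioi_subset_Ici_self).trans (Ici_subset_Ici.2 hr.1.le))).const_mul _).congr_deriv ?_
      rw [hφ]
      ring
    have hψN := tendsto_truncation e ψ
    have hφN := tendsto_truncation e φ
    have hl1 : Tendsto (fun N => ∫ r in (0 : ℝ)..s,
        (inner ℝ (truncation e N ψ) (w r) + inner ℝ (truncation e N φ) (f r))) atTop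
        (𝓝 (∫ r in (0 : ℝ)..s, h r)) := by
      refine intervalIntegral.tendsto_integral_filter_of_dominated_convergence
        (fun r => ‖ψ‖ * ‖w r‖ + ‖φ‖ * ‖f r‖)
        (Eventually.of_forall fun N => Continuous.aestronglyMeasurable (by fun_prop))
        (Eventually.of_forall fun N => ae_of_all _ fun r _ => ?_)
        (Continuous.intervalIntegrable (by fun_prop) _ _)
        (ae_of_all _ fun r _ =>
          (hψN.inner tendsto_const_nhds).add (hφN.inner tendsto_const_nhds))
      refine (norm_add_le _ _).trans (add_le_add ?_ ?_)
      · exact (norm_inner_le_norm _ _).trans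
          (mul_le_mul_of_nonneg_right (norm_truncation_le e N ψ) (norm_nonneg _))
      · exact (norm_inner_le_norm _ _).trans
          (mul_le_mul_of_nonneg_right (norm_truncation_le e N φ) (norm_nonneg _))
    have hl2 : Tendsto (fun N => inner ℝ (truncation e N φ) (w s)
        - inner ℝ (truncation e N φ) (w 0)) atTop (𝓝 (inner ℝ φ (w s) - inner ℝ φ (w 0))) :=
      (hφN.inner tendsto_const_nhds).sub (hφN.inner tendsto_const_nhds)
    simp only [hN] at hl1
    have := tendsto_nhds_unique hl1 hl2
    linarith
  exact ((((hhc.integral_hasStrictDerivAt 0 t).hasDerivAt.const_add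
    (inner ℝ φ (w 0))).hasDerivWithinAt (s := Ici 0)).congr hform (hform t ht))

end Existence

/-! ### Symmetry of the operator -/

/-- Green's formula: `A` is symmetric. The reaction terms cancel pointwise, so that the product
`c φ χ` need not be integrated, and the boundary terms vanish by the Dirichlet conditions. -/
theorem IsOp.inner_comm {L : ℝ} (hL : 0 < L) {c φ ψ χ η : X L} (h₁ : IsOp c φ ψ)
    (h₂ : IsOp c χ η) : inner ℝ ψ χ = inner ℝ φ η := by
  obtain ⟨φ₂, ⟨y, p, hy, hyac, hpac, hyd, hpd, hy0, hyL⟩, hψ⟩ := h₁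
  obtain ⟨χ₂, ⟨u, q, hu, huac, hqac, hud, hqd, hu0, huL⟩, hη⟩ := h₂
  have hI₁ := L2.integrable_inner (𝕜 := ℝ) ψ χ
  have hI₂ := L2.integrable_inner (𝕜 := ℝ) φ η
  rw [L2.inner_def, L2.inner_def, ← sub_eq_zero, ← integral_sub hI₁ hI₂]
  -- both sides differ by the integral of the derivative of the Wronskian `p u - y q`
  have hW := ((hpac.mul huac).sub (hyac.mul hqac)).integral_deriv_eq_sub
  rw [intervalIntegral.integral_of_le hL.le, ← restrict_Ioo_eq_restrict_Ioc] at hW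
  have hW0 : (p * u - y * q) L - (p * u - y * q) 0 = 0 := by simp [hy0, hyL, hu0, huL]
  refine (integral_congr_ae ?_).trans (hW.trans hW0)
  filter_upwards [hy, hyd, hpd, hψ, hu, hud, hqd, hη] with x hy hyd hpd hψ hu hud hqd hη
  have hd := ((hpd.mul hud).sub (hyd.mul hqd)).deriv
  rw [hd]
  simp only [RCLike.inner_apply, conj_trivial]
  rw [hψ, hη, hy, hu]
  ring

/-! ### Dini derivatives -/

theorem diniUpper_le_coe_iff {g : ℝ → ℝ} {t r : ℝ} :
    diniUpper g t ≤ (r : EReal) ↔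
      ∀ r' > r, ∀ᶠ h in 𝓝[>] (0 : ℝ), (g (t + h) - g t) / h < r' := by
  unfold diniUpper
  rw [limsup_le_iff]
  constructor
  · intro H r' hr'
    exact (H r' (EReal.coe_lt_coe_iff.2 hr')).mono fun h hh => EReal.coe_lt_coe_iff.1 hh
  · intro H y hy
    obtain ⟨r', hr', hy'⟩ := EReal.lt_iff_exists_real_btwn.1 hy
    exact (H r' (EReal.coe_lt_coe_iff.1 hr')).mono fun h hh =>
      (EReal.coe_lt_coe_iff.2 hh).trans hy'

theorem tendsto_quotient_of_hasDerivWithinAt {g : ℝ → ℝ} {g' t : ℝ}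
    (hg : HasDerivWithinAt g g' (Ici t) t) :
    Tendsto (fun h => (g (t + h) - g t) / h) (𝓝[>] 0) (𝓝 g') := by
  have h1 := (hasDerivWithinAt_iff_tendsto_slope' self_notMem_Ioi).1 hg.Ioi_of_Ici
  have h2 : Tendsto (fun h : ℝ => t + h) (𝓝[>] 0) (𝓝[>] t) := by
    refine tendsto_nhdsWithin_iff.2 ⟨?_, ?_⟩
    · have : Tendsto (fun h : ℝ => t + h) (𝓝 0) (𝓝 (t + 0)) := by
        exact (continuous_const.add continuous_id).tendsto 0
      rw [add_zero] at this
      exact this.mono_left nhdsWithin_le_nhds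
    · filter_upwards [self_mem_nhdsWithin] with h hh
      exact lt_add_of_pos_right t hh
  refine (h1.comp h2).congr fun h => ?_
  simp [slope_def_field]

theorem diniUpper_eq_of_hasDerivWithinAt {g : ℝ → ℝ} {g' t : ℝ}
    (hg : HasDerivWithinAt g g' (Ici t) t) : diniUpper g t = (g' : EReal) :=
  ((continuous_coe_real_ereal.tendsto g').comp
    (tendsto_quotient_of_hasDerivWithinAt hg)).limsup_eq

/-! ### Energy of the tail -/

section Tail

variable {H : Type*} [NormedAddCommGroup H] [InnerProductSpace ℝ H]

theorem tendsto_truncation_prod (e : HilbertBasis ℕ ℝ H) {ι : Type*} {l : Filter ι} {x : ι → H}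
    {a : H} (hx : Tendsto x l (𝓝 a)) :
    Tendsto (fun p : ℕ × ι => truncation e p.1 (x p.2)) (atTop ×ˢ l) (𝓝 a) := by
  have h1 : Tendsto (fun p : ℕ × ι => truncation e p.1 a) (atTop ×ˢ l) (𝓝 a) :=
    (tendsto_truncation e a).comp tendsto_fst
  have h2 : Tendsto (fun p : ℕ × ι => truncation e p.1 (x p.2 - a)) (atTop ×ˢ l) (𝓝 0) := by
    refine squeeze_zero_norm (fun p => norm_truncation_le e p.1 _) ?_
    have := (hx.sub_const a).norm.comp (tendsto_snd (f := (atTop : Filter ℕ)))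
    simpa [Function.comp_def] using this
  have := h1.add h2
  rw [add_zero] at this
  refine this.congr fun p => ?_
  rw [map_sub, add_sub_cancel]

/-- Energy estimate for the modes `j ≥ N`. It is proved for finitely many modes, where the energy is
differentiable; the estimate is uniform in their number near `t`. -/
theorem eventually_tail_energy_le (e : HilbertBasis ℕ ℝ H) {lam : ℕ → ℝ} {w f : ℝ → H}
    (hw : ContinuousOn w (Ici 0)) (hf : ContinuousOn f (Ici 0))
    (hmodal : ∀ j t, 0 ≤ t → HasDerivWithinAt (fun s => inner ℝ (e j) (w s))
        (lam j * inner ℝ (e j) (w t) + inner ℝ (e j) (f t)) (Ici 0) t)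
    {N : ℕ} {μ : ℝ} (hμ : ∀ j, N ≤ j → lam j ≤ μ) {t : ℝ} (ht : 0 ≤ t) {r : ℝ}
    (hr : 2 * (μ * ‖w t - truncation e N (w t)‖ ^ 2
      + inner ℝ (w t - truncation e N (w t)) (f t)) < r) :
    ∀ᶠ h in 𝓝[>] (0 : ℝ), (‖w (t + h) - truncation e N (w (t + h))‖ ^ 2
      - ‖w t - truncation e N (w t)‖ ^ 2) / h ≤ r := by
  set y : ℝ → H := fun s => w s - truncation e N (w s) with hy
  have hyj : ∀ j s, inner ℝ (e j) (y s) = if j < N then 0 else inner ℝ (e j) (w s) := by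
    intro j s
    simp only [hy, inner_sub_right, inner_basis_truncation]
    split_ifs <;> simp
  have hyd : ∀ j s, 0 ≤ s → ∃ d, HasDerivWithinAt (fun s => inner ℝ (e j) (y s)) d (Ici 0) s ∧
      inner ℝ (e j) (y s) * d
        ≤ μ * inner ℝ (e j) (y s) ^ 2 + inner ℝ (e j) (y s) * inner ℝ (e j) (f s) := by
    intro j s hs
    simp only [hyj]
    by_cases hj : j < N
    · refine ⟨0, ?_, ?_⟩
      · simpa [hj] using hasDerivWithinAt_const s (Ici (0 : ℝ)) (0 : ℝ)
      · simp [hj]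
    · refine ⟨_, by simpa [hj] using hmodal j s hs, ?_⟩
      simp only [hj, if_false]
      have := hμ j (not_lt.1 hj)
      nlinarith [sq_nonneg (inner ℝ (e j) (w s))]
  have hsub : Ici t ⊆ Ici (0 : ℝ) := Ici_subset_Ici.2 ht
  have hyc : ContinuousOn y (Ici 0) :=
    hw.sub ((truncation e N).continuous.comp_continuousOn hw)
  have hyt : Tendsto y (𝓝[≥] t) (𝓝 (y t)) := ((hyc t ht).mono hsub).tendsto
  have hft : Tendsto f (𝓝[≥] t) (𝓝 (f t)) := ((hf t ht).mono hsub).tendsto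
  have h1 := tendsto_truncation_prod e hyt
  have h2 : Tendsto (fun p : ℕ × ℝ => f p.2) (atTop ×ˢ 𝓝[≥] t) (𝓝 (f t)) :=
    hft.comp tendsto_snd
  have h3 := (((h1.norm.pow 2).const_mul μ).add (h1.inner h2)).const_mul 2
  obtain ⟨pa, hpa, pb, hpb, hp⟩ := eventually_prod_iff.1 (h3.eventually (gt_mem_nhds hr))
  obtain ⟨u, hu, hub⟩ := mem_nhdsGE_iff_exists_Icc_subset.1 hpb
  -- the estimate for finitely many modes, by the mean value inequality
  have hM : ∀ᶠ M in atTop, ∀ s ∈ Icc t u,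
      ‖truncation e M (y s)‖ ^ 2 ≤ ‖truncation e M (y t)‖ ^ 2 + r * (s - t) := by
    filter_upwards [hpa] with M hMpa
    choose! d hd hdle using hyd
    refine image_le_of_deriv_right_le_deriv_boundary
      (f := fun s => ‖truncation e M (y s)‖ ^ 2)
      (f' := fun s => ∑ j ∈ Finset.range M, 2 * (inner ℝ (e j) (y s) * d j s))
      (B := fun s => ‖truncation e M (y t)‖ ^ 2 + r * (s - t)) (B' := fun _ => r) ?_ ?_ ?_ ?_ ?_ ?_
    · exact (((truncation e M).continuous.comp_continuousOn
        (hyc.mono (Icc_subset_Ici_self.trans hsub))).norm.pow 2)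
    · intro s hs
      simp only [norm_sq_truncation]
      refine HasDerivWithinAt.fun_sum fun j _ => ?_
      refine (((hd j s (ht.trans hs.1)).mono
        (Ici_subset_Ici.2 (ht.trans hs.1))).pow 2).congr_deriv ?_
      push_cast
      ring
    · simp
    · fun_prop
    · intro s _
      simpa using
        ((((hasDerivWithinAt_id s (Ici s)).sub_const t).const_mul r).const_add
          (‖truncation e M (y t)‖ ^ 2))
    · intro s hs
      have h4 := hp hMpa (hub ⟨hs.1, hs.2.le⟩)
      refine le_trans ?_ h4.le
      dsimp only
      rw [norm_sq_truncation, inner_truncation_left, Finset.mul_sum, ← Finset.sum_add_distrib,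
        Finset.mul_sum]
      exact Finset.sum_le_sum fun j _ =>
        mul_le_mul_of_nonneg_left (hdle j s (ht.trans hs.1)) zero_le_two
  have hlim : ∀ s ∈ Icc t u, ‖y s‖ ^ 2 ≤ ‖y t‖ ^ 2 + r * (s - t) := fun s hs =>
    le_of_tendsto_of_tendsto ((tendsto_truncation e (y s)).norm.pow 2)
      (((tendsto_truncation e (y t)).norm.pow 2).add_const _) (hM.mono fun M h => h s hs)
  have hmem : ∀ᶠ h in 𝓝[>] (0 : ℝ), h ∈ Ioo 0 (u - t) := Ioo_mem_nhdsGT (by linarith)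
  filter_upwards [hmem] with h hh
  rw [div_le_iff₀ hh.1]
  have := hlim (t + h) ⟨by linarith [hh.1], by linarith [hh.2]⟩
  rw [add_sub_cancel_left] at this
  linarith

end Tail

/-! ### The derivative of the Lyapunov function -/

section Lyapunov

variable {L : ℝ} {n : ℕ}

theorem lyap_eq (e : HilbertBasis ℕ ℝ (X L)) (P : Matrix (Fin n) (Fin n) ℝ) (γ : ℝ) (w : X L) :
    lyap e P γ w = quad P (modes e n w) + γ * ‖w - truncation e n w‖ ^ 2 := by
  rw [lyap, tsum_sq_inner_basis_add]

/-- The part `zᵀ P z + γ ∑_{n ≤ j < N} w_j²` of the Lyapunov function. -/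
def headLyap (e : HilbertBasis ℕ ℝ (X L)) (P : Matrix (Fin n) (Fin n) ℝ) (γ : ℝ) (N : ℕ)
    (w : X L) : ℝ :=
  quad P (modes e n w) + γ * ∑ j ∈ Finset.Ico n N, inner ℝ (e j) w ^ 2

/-- The derivative of `headLyap` along `w' = A w + f`, as a function of the state and the input. -/
def headDeriv (e : HilbertBasis ℕ ℝ (X L)) (lam : ℕ → ℝ) (P : Matrix (Fin n) (Fin n) ℝ) (γ : ℝ)
    (N : ℕ) (w f : X L) : ℝ :=
  (∑ i : Fin n, ((lam i * inner ℝ (e i) w + inner ℝ (e i) f) * ∑ j : Fin n, P i j * inner ℝ (e j) w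
    + inner ℝ (e i) w * ∑ j : Fin n, P i j * (lam j * inner ℝ (e j) w + inner ℝ (e j) f)))
  + γ * ∑ j ∈ Finset.Ico n N, 2 * inner ℝ (e j) w * (lam j * inner ℝ (e j) w + inner ℝ (e j) f)

theorem lyap_eq_headLyap_add (e : HilbertBasis ℕ ℝ (X L)) (P : Matrix (Fin n) (Fin n) ℝ) (γ : ℝ)
    {N : ℕ} (hN : n ≤ N) (w : X L) :
    lyap e P γ w = headLyap e P γ N w + γ * ‖w - truncation e N w‖ ^ 2 := by
  have h1 := norm_sq_eq_truncation_add e n w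
  have h2 := norm_sq_eq_truncation_add e N w
  rw [norm_sq_truncation] at h1 h2
  rw [lyap_eq, headLyap, Finset.sum_Ico_eq_sub _ hN]
  linear_combination γ * (h2 - h1)

theorem headDeriv_truncation (e : HilbertBasis ℕ ℝ (X L)) (lam : ℕ → ℝ)
    (P : Matrix (Fin n) (Fin n) ℝ) (γ : ℝ) {N : ℕ} (hN : n ≤ N) (w f : X L) :
    headDeriv e lam P γ N (truncation e N w) f = headDeriv e lam P γ N w f := by
  have h1 : ∀ i : Fin n, inner ℝ (e i) (truncation e N w) = inner ℝ (e i) w := fun i => by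
    rw [inner_basis_truncation, if_pos (i.2.trans_le hN)]
  have h2 : ∀ j ∈ Finset.Ico n N, inner ℝ (e j) (truncation e N w) = inner ℝ (e j) w :=
    fun j hj => by rw [inner_basis_truncation, if_pos (Finset.mem_Ico.1 hj).2]
  simp only [headDeriv, h1]
  congr 2
  exact Finset.sum_congr rfl fun j hj => by rw [h2 j hj]

theorem hasDerivWithinAt_headLyap (e : HilbertBasis ℕ ℝ (X L)) (lam : ℕ → ℝ)
    (P : Matrix (Fin n) (Fin n) ℝ) (γ : ℝ) (N : ℕ) {w f : ℝ → X L} {s : Set ℝ} {t : ℝ}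
    (hmodal : ∀ j, HasDerivWithinAt (fun s => inner ℝ (e j) (w s))
      (lam j * inner ℝ (e j) (w t) + inner ℝ (e j) (f t)) s t) :
    HasDerivWithinAt (fun s => headLyap e P γ N (w s)) (headDeriv e lam P γ N (w t) (f t)) s t := by
  simp only [headLyap, headDeriv, quad, modes, dotProduct, Matrix.mulVec]
  refine HasDerivWithinAt.add (HasDerivWithinAt.fun_sum fun i _ => ?_)
    ((HasDerivWithinAt.fun_sum fun j _ => ?_).const_mul γ)
  · exact (hmodal i).mul (HasDerivWithinAt.fun_sum fun j _ => (hmodal j).const_mul (P i j))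
  · exact ((hmodal j).fun_pow 2).congr_deriv (by simp)

/-- Upper estimate of the Dini derivative of the Lyapunov function: exact on the modes `j < N`,
dissipative on the others. -/
theorem diniUpper_lyap_le (e : HilbertBasis ℕ ℝ (X L)) {lam : ℕ → ℝ}
    (P : Matrix (Fin n) (Fin n) ℝ) {γ : ℝ} (hγ : 0 < γ) {w f : ℝ → X L}
    (hw : ContinuousOn w (Ici 0)) (hf : ContinuousOn f (Ici 0))
    (hmodal : ∀ j t, 0 ≤ t → HasDerivWithinAt (fun s => inner ℝ (e j) (w s))
        (lam j * inner ℝ (e j) (w t) + inner ℝ (e j) (f t)) (Ici 0) t)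
    {N : ℕ} (hN : n ≤ N) {μ : ℝ} (hμ : ∀ j, N ≤ j → lam j ≤ μ) {t : ℝ} (ht : 0 ≤ t) :
    diniUpper (fun s => lyap e P γ (w s)) t ≤
      ((headDeriv e lam P γ N (w t) (f t) + γ * (2 * (μ * ‖w t - truncation e N (w t)‖ ^ 2
        + inner ℝ (w t - truncation e N (w t)) (f t))) : ℝ) : EReal) := by
  rw [diniUpper_le_coe_iff]
  intro r' hr'
  set D := headDeriv e lam P γ N (w t) (f t)
  set R := 2 * (μ * ‖w t - truncation e N (w t)‖ ^ 2
        + inner ℝ (w t - truncation e N (w t)) (f t))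
  set ε := (r' - (D + γ * R)) / 2 with hε
  have hε0 : 0 < ε := by rw [hε]; linarith
  have h1 := tendsto_quotient_of_hasDerivWithinAt (hasDerivWithinAt_headLyap e lam P γ N
    (w := w) (f := f) (s := Ici t) (t := t)
    fun j => (hmodal j t ht).mono (Ici_subset_Ici.2 ht))
  have h2 := eventually_tail_energy_le e hw hf hmodal hμ ht (r := R + ε / γ)
    (by simpa [R] using div_pos hε0 hγ)
  filter_upwards [h1.eventually (gt_mem_nhds (show D < D + ε by linarith)), h2] with h h3 h4
  simp only [lyap_eq_headLyap_add e P γ hN]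
  have h5 := mul_le_mul_of_nonneg_left h4 hγ.le
  rw [mul_add, mul_div_cancel₀ _ hγ.ne'] at h5
  calc _ = (headLyap e P γ N (w (t + h)) - headLyap e P γ N (w t)) / h
        + γ * ((‖w (t + h) - truncation e N (w (t + h))‖ ^ 2
          - ‖w t - truncation e N (w t)‖ ^ 2) / h) := by ring
    _ < (D + ε) + (γ * R + ε) := add_lt_add_of_lt_of_le h3 h5
    _ = r' := by rw [hε]; ring

/-- Lower estimate of the Dini derivative of the Lyapunov function at a state that involves only
the modes `j < N`: there the other modes, zero at first, can only increase the function. -/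
theorem headDeriv_le_of_diniUpper_le (e : HilbertBasis ℕ ℝ (X L)) {lam : ℕ → ℝ}
    (P : Matrix (Fin n) (Fin n) ℝ) {γ : ℝ} (hγ : 0 < γ) {w f : ℝ → X L} {t : ℝ}
    (hmodal : ∀ j, HasDerivWithinAt (fun s => inner ℝ (e j) (w s))
        (lam j * inner ℝ (e j) (w t) + inner ℝ (e j) (f t)) (Ici t) t)
    {N : ℕ} (hN : n ≤ N) (hwN : truncation e N (w t) = w t) {r : ℝ}
    (hr : diniUpper (fun s => lyap e P γ (w s)) t ≤ (r : EReal)) :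
    headDeriv e lam P γ N (w t) (f t) ≤ r := by
  refine le_of_forall_gt_imp_ge_of_dense fun r' hr' => ?_
  refine le_of_tendsto
    (tendsto_quotient_of_hasDerivWithinAt (hasDerivWithinAt_headLyap e lam P γ N hmodal)) ?_
  filter_upwards [diniUpper_le_coe_iff.1 hr r' hr', self_mem_nhdsWithin] with h hh h0
  refine le_trans ?_ hh.le
  refine div_le_div_of_nonneg_right ?_ (le_of_lt h0)
  simp only [lyap_eq_headLyap_add e P γ hN]
  rw [hwN, sub_self, norm_zero]
  have : 0 ≤ γ * ‖w (t + h) - truncation e N (w (t + h))‖ ^ 2 := by positivity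
  linarith

theorem quad_eq_headLyap (e : HilbertBasis ℕ ℝ (X L)) (P : Matrix (Fin n) (Fin n) ℝ) (γ : ℝ)
    (w : X L) : quad P (modes e n w) = headLyap e P γ n w := by
  simp [headLyap]

theorem norm_modes (e : HilbertBasis ℕ ℝ (X L)) (n : ℕ) (w : X L) :
    ‖modes e n w‖ = ‖truncation e n w‖ := by
  rw [← sq_eq_sq₀ (norm_nonneg _) (norm_nonneg _), EuclideanSpace.norm_sq_eq,
    norm_sq_truncation, ← Fin.sum_univ_eq_sum_range (fun j => inner ℝ (e j) w ^ 2)]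
  simp [modes]

theorem modes_truncation (e : HilbertBasis ℕ ℝ (X L)) {N : ℕ} (hN : n ≤ N) (w : X L) :
    modes e n (truncation e N w) = modes e n w := by
  ext j
  simp only [modes]
  rw [inner_basis_truncation, if_pos (j.2.trans_le hN)]

theorem continuous_quad (P : Matrix (Fin n) (Fin n) ℝ) : Continuous (quad P) := by
  unfold quad
  simp only [dotProduct, Matrix.mulVec]
  fun_prop

theorem exists_quad_bounds {P : Matrix (Fin n) (Fin n) ℝ} (hP : P.PosDef) :
    ∃ p q : ℝ, 0 < p ∧ 0 < q ∧ ∀ z, p * ‖z‖ ^ 2 ≤ quad P z ∧ quad P z ≤ q * ‖z‖ ^ 2 := by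
  have hsm : ∀ (r : ℝ) z, quad P (r • z) = r ^ 2 * quad P z := fun r z => by
    simp only [quad, WithLp.ofLp_smul, Matrix.mulVec_smul, smul_dotProduct, dotProduct_smul,
      smul_eq_mul]
    ring
  have hpos : ∀ z, z ≠ 0 → 0 < quad P z := fun z hz => by
    have := hP.dotProduct_mulVec_pos (x := z.ofLp) (by simpa using hz)
    simpa [quad] using this
  have hcpt : IsCompact (Metric.sphere (0 : EuclideanSpace ℝ (Fin n)) 1) := isCompact_sphere 0 1
  rcases (Metric.sphere (0 : EuclideanSpace ℝ (Fin n)) 1).eq_empty_or_nonempty with h | h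
  · have hz : ∀ z : EuclideanSpace ℝ (Fin n), z = 0 := fun z => by
      by_contra hz
      have : ‖z‖⁻¹ • z ∈ Metric.sphere (0 : EuclideanSpace ℝ (Fin n)) 1 := by
        simp [norm_smul, norm_ne_zero_iff.2 hz]
      simp [h] at this
    exact ⟨1, 1, one_pos, one_pos, fun z => by simp [hz z, quad]⟩
  · obtain ⟨a, ha, hmin⟩ := hcpt.exists_isMinOn h (continuous_quad P).continuousOn
    obtain ⟨b, hb, hmax⟩ := hcpt.exists_isMaxOn h (continuous_quad P).continuousOn
    have hne : ∀ z ∈ Metric.sphere (0 : EuclideanSpace ℝ (Fin n)) 1, z ≠ 0 := fun z hz hz0 => by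
      simp [hz0] at hz
    refine ⟨quad P a, quad P b, hpos a (hne a ha), hpos b (hne b hb), fun z => ?_⟩
    by_cases hz : z = 0
    · simp [hz, quad]
    have hmem : ‖z‖⁻¹ • z ∈ Metric.sphere (0 : EuclideanSpace ℝ (Fin n)) 1 := by
      simp [norm_smul, norm_ne_zero_iff.2 hz]
    have h0 : quad P z = ‖z‖ ^ 2 * quad P (‖z‖⁻¹ • z) := by
      rw [← hsm, smul_smul, mul_inv_cancel₀ (norm_ne_zero_iff.2 hz), one_smul]
    rw [h0, mul_comm (quad P a), mul_comm (quad P b)]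
    exact ⟨mul_le_mul_of_nonneg_left (hmin hmem) (sq_nonneg _),
      mul_le_mul_of_nonneg_left (hmax hmem) (sq_nonneg _)⟩

end Lyapunov

section Input

variable {L : ℝ} {m n : ℕ}

/-! ### The saturated feedback inputs -/

/-- The vector of `L²(0, L)` that represents the functional `w ↦ (𝐊 z)ₖ`. -/
def gain (e : HilbertBasis ℕ ℝ (X L)) (K : Matrix (Fin m) (Fin n) ℝ) (k : Fin m) : X L :=
  ∑ j : Fin n, K k j • e j

theorem mulVec_modes (e : HilbertBasis ℕ ℝ (X L)) (K : Matrix (Fin m) (Fin n) ℝ) (k : Fin m)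
    (w : X L) : (K *ᵥ (modes e n w).ofLp) k = inner ℝ (gain e K k) w := by
  simp [gain, modes, Matrix.mulVec, dotProduct, sum_inner, inner_smul_left]

theorem abs_mulVec_modes_le (e : HilbertBasis ℕ ℝ (X L)) (K : Matrix (Fin m) (Fin n) ℝ)
    (k : Fin m) (w : X L) :
    |(K *ᵥ (modes e n w).ofLp) k| ≤ ‖gain e K k‖ * ‖truncation e n w‖ := by
  rw [← modes_truncation e le_rfl w, mulVec_modes]
  exact abs_real_inner_le_norm _ _

theorem abs_sat_sub_le {ℓ : ℝ} (hℓ : 0 < ℓ) (r s : ℝ) : |sat ℓ r - sat ℓ s| ≤ |r - s| := by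
  simpa [Real.dist_eq] using (lipschitzWith_sat hℓ).dist_le_mul r s

theorem componentwiseInput_zero {ℓ : ℝ} (hℓ : 0 < ℓ) (e : HilbertBasis ℕ ℝ (X L))
    (b : Fin m → X L) (K : Matrix (Fin m) (Fin n) ℝ) : componentwiseInput ℓ e b K 0 = 0 := by
  simp [componentwiseInput, mulVec_modes, sat_zero hℓ]

theorem pointwiseInput_zero {ℓ : ℝ} (hℓ : 0 < ℓ) (e : HilbertBasis ℕ ℝ (X L))
    (b : Fin m → X L) (K : Matrix (Fin m) (Fin n) ℝ) : pointwiseInput hℓ e b K 0 = 0 := by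
  simp [pointwiseInput, mulVec_modes, satInf]

theorem norm_componentwiseInput_sub_le {ℓ : ℝ} (hℓ : 0 < ℓ) (e : HilbertBasis ℕ ℝ (X L))
    (b : Fin m → X L) (K : Matrix (Fin m) (Fin n) ℝ) (w v : X L) :
    ‖componentwiseInput ℓ e b K w - componentwiseInput ℓ e b K v‖
      ≤ (∑ k, ‖gain e K k‖ * ‖b k‖) * ‖w - v‖ := by
  rw [componentwiseInput, componentwiseInput, ← Finset.sum_sub_distrib, Finset.sum_mul]
  refine (norm_sum_le _ _).trans (Finset.sum_le_sum fun k _ => ?_)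
  rw [← sub_smul, norm_smul, mul_right_comm, mulVec_modes, mulVec_modes, Real.norm_eq_abs]
  refine mul_le_mul_of_nonneg_right ((abs_sat_sub_le hℓ _ _).trans ?_) (norm_nonneg _)
  rw [← inner_sub_right]
  exact abs_real_inner_le_norm _ _

theorem norm_pointwiseInput_sub_le {ℓ : ℝ} (hℓ : 0 < ℓ) (e : HilbertBasis ℕ ℝ (X L))
    (b : Fin m → X L) (K : Matrix (Fin m) (Fin n) ℝ) (w v : X L) :
    ‖pointwiseInput hℓ e b K w - pointwiseInput hℓ e b K v‖
      ≤ (∑ k, ‖gain e K k‖ * ‖b k‖) * ‖w - v‖ := by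
  rw [pointwiseInput, pointwiseInput, ← Finset.sum_sub_distrib, Finset.sum_mul]
  refine (norm_sum_le _ _).trans (Finset.sum_le_sum fun k _ => ?_)
  refine ((lipschitzWith_sat hℓ).norm_compLp_sub_le (sat_zero hℓ) _ _).trans ?_
  rw [← sub_smul, norm_smul, mul_right_comm, mulVec_modes, mulVec_modes, Real.norm_eq_abs,
    NNReal.coe_one, one_mul, ← inner_sub_right]
  exact mul_le_mul_of_nonneg_right (abs_real_inner_le_norm _ _) (norm_nonneg _)

theorem componentwiseInput_truncation (ℓ : ℝ) (e : HilbertBasis ℕ ℝ (X L)) (b : Fin m → X L)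
    (K : Matrix (Fin m) (Fin n) ℝ) {N : ℕ} (hN : n ≤ N) (w : X L) :
    componentwiseInput ℓ e b K (truncation e N w) = componentwiseInput ℓ e b K w := by
  simp only [componentwiseInput, modes_truncation e hN]

theorem norm_componentwiseInput_le {ℓ : ℝ} (hℓ : 0 < ℓ) (e : HilbertBasis ℕ ℝ (X L))
    (b : Fin m → X L) (K : Matrix (Fin m) (Fin n) ℝ) (w : X L) :
    ‖componentwiseInput ℓ e b K w‖
      ≤ (∑ k, ‖gain e K k‖ * ‖b k‖) * ‖truncation e n w‖ := by
  have h := norm_componentwiseInput_sub_le hℓ e b K (truncation e n w) 0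
  rwa [componentwiseInput_zero hℓ, sub_zero, sub_zero,
    componentwiseInput_truncation ℓ e b K le_rfl] at h

theorem satInf_eq_self {ℓ : ℝ} (hℓ : 0 < ℓ) {u : X L} (hu : ∀ᵐ x ∂(leb L), |u x| ≤ ℓ) :
    satInf hℓ u = u := by
  refine Lp.ext ?_
  filter_upwards [(lipschitzWith_sat hℓ).coeFn_compLp (sat_zero hℓ) u, hu] with x hx hux
  rw [satInf, hx, Function.comp_apply, sat, if_pos hux]

/-- Near `z = 0` neither saturation is active, so that the two inputs coincide. This is where the
profiles `b k` have to be essentially bounded. -/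
theorem exists_pointwiseInput_eq {ℓ : ℝ} (hℓ : 0 < ℓ) (e : HilbertBasis ℕ ℝ (X L))
    (b : Fin m → X L) (hb : ∀ k, MemLp (b k : ℝ → ℝ) ⊤ (leb L))
    (K : Matrix (Fin m) (Fin n) ℝ) :
    ∃ δ : ℝ, 0 < δ ∧ ∀ w, ‖truncation e n w‖ ≤ δ →
      pointwiseInput hℓ e b K w = componentwiseInput ℓ e b K w := by
  have hbound : ∀ k, ∃ M : ℝ, 0 ≤ M ∧ ∀ᵐ x ∂(leb L), |b k x| ≤ M := fun k => by
    refine ⟨_, ENNReal.toReal_nonneg (a := eLpNormEssSup (b k : ℝ → ℝ) (leb L)), ?_⟩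
    have hfin : eLpNormEssSup (b k : ℝ → ℝ) (leb L) ≠ ⊤ := by
      have := (hb k).2.ne
      rwa [eLpNorm_exponent_top] at this
    filter_upwards [ae_le_eLpNormEssSup (f := (b k : ℝ → ℝ)) (μ := leb L)] with x hx
    have := ENNReal.toReal_mono hfin hx
    simpa using this
  choose M hM0 hM using hbound
  set B : ℝ := 1 + ∑ k, ‖gain e K k‖ * (1 + M k) with hB
  have hterm : ∀ k, 0 ≤ ‖gain e K k‖ * (1 + M k) := fun k =>
    mul_nonneg (norm_nonneg _) (by linarith [hM0 k])
  have hB0 : 0 < B := by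
    have := Finset.sum_nonneg fun k (_ : k ∈ Finset.univ) => hterm k
    linarith
  clear_value B
  refine ⟨ℓ / B, div_pos hℓ hB0, fun w hw => ?_⟩
  refine Finset.sum_congr rfl fun k _ => ?_
  set a := (K *ᵥ (modes e n w).ofLp) k with ha_def
  have ha : |a| * (1 + M k) ≤ ℓ := by
    have h1 : ‖gain e K k‖ * (1 + M k) ≤ B := by
      have := Finset.single_le_sum (fun i _ => hterm i) (Finset.mem_univ k)
      rw [hB]
      linarith
    have h2 : |a| ≤ ‖gain e K k‖ * (ℓ / B) := (abs_mulVec_modes_le e K k w).trans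
      (mul_le_mul_of_nonneg_left hw (norm_nonneg _))
    calc |a| * (1 + M k) ≤ ‖gain e K k‖ * (ℓ / B) * (1 + M k) :=
          mul_le_mul_of_nonneg_right h2 (by linarith [hM0 k])
      _ = ‖gain e K k‖ * (1 + M k) * (ℓ / B) := by ring
      _ ≤ B * (ℓ / B) := mul_le_mul_of_nonneg_right h1 (div_pos hℓ hB0).le
      _ = ℓ := mul_div_cancel₀ ℓ hB0.ne'
  clear_value a
  have ha1 : |a| ≤ ℓ :=
    (le_mul_of_one_le_right (abs_nonneg a) (by linarith [hM0 k])).trans ha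
  rw [satInf_eq_self hℓ, sat, if_pos ha1]
  filter_upwards [hM k, Lp.coeFn_smul a (b k)] with x hx hs
  rw [hs, Pi.smul_apply, smul_eq_mul, abs_mul]
  have := mul_le_mul_of_nonneg_left hx (abs_nonneg a)
  linarith [abs_nonneg a]

/-! ### Solutions and their modes -/

variable {c : X L} {e : HilbertBasis ℕ ℝ (X L)} {lam : ℕ → ℝ}

theorem IsSolution.modal (he : ∀ j, IsOp c (e j) (lam j • e j)) {F : X L → X L} {w : ℝ → X L}
    (hw : IsSolution c F w) (j : ℕ) (t : ℝ) (ht : 0 ≤ t) :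
    HasDerivWithinAt (fun s => inner ℝ (e j) (w s))
      (lam j * inner ℝ (e j) (w t) + inner ℝ (e j) (F (w t))) (Ici 0) t := by
  refine (hw.2 _ _ (he j) t ht).congr_deriv ?_
  rw [real_inner_smul_left]

theorem exists_isSolution (hL : 0 < L) (he : ∀ j, IsOp c (e j) (lam j • e j))
    (hlam : Antitone lam) {F : X L → X L} (hF0 : F 0 = 0) {κ : ℝ}
    (hF : ∀ x y, ‖F x - F y‖ ≤ κ * ‖x - y‖) (w₀ : X L) :
    ∃ w, IsSolution c F w ∧ w 0 = w₀ := by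
  obtain ⟨w, hwc, hw0, hmodal⟩ :=
    exists_modal_solution e (fun j => hlam (Nat.zero_le j)) hF0 hF w₀
  refine ⟨w, ⟨hwc.continuousOn, fun φ ψ hφ t ht => ?_⟩, hw0⟩
  refine hasDerivWithinAt_inner_of_modal e hwc ((continuous_of_norm_sub_le hF).comp hwc) hmodal
    (fun j => ?_) ht
  have h := IsOp.inner_comm hL hφ (he j)
  rwa [inner_smul_right, real_inner_comm, real_inner_comm _ φ] at h

theorem isSolution_zero {F : X L → X L} (hF0 : F 0 = 0) : IsSolution c F fun _ => 0 := by
  refine ⟨continuousOn_const, fun φ ψ _ t _ => ?_⟩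
  simpa [hF0] using hasDerivWithinAt_const t (Ici (0 : ℝ)) (0 : ℝ)

/-- The modes of a solution with componentwise saturated input solve the finite-dimensional
system, which is thus decoupled from the other modes. -/
theorem isFinSolution_modes (he : ∀ j, IsOp c (e j) (lam j • e j)) {ℓ : ℝ} {b : Fin m → X L}
    {K : Matrix (Fin m) (Fin n) ℝ} {w : ℝ → X L}
    (hw : IsSolution c (componentwiseInput ℓ e b K) w) :
    IsFinSolution ℓ (matA lam n) (matB e b n) K fun t => modes e n (w t) := by
  intro t ht
  have h : HasDerivWithinAt (fun s => (modes e n (w s)).ofLp)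
      (matA lam n *ᵥ (modes e n (w t)).ofLp
        + matB e b n *ᵥ fun k => sat ℓ ((K *ᵥ (modes e n (w t)).ofLp) k)) (Ici 0) t := by
    rw [hasDerivWithinAt_pi]
    intro j
    refine (hw.modal he j t ht).congr_deriv ?_
    simp only [matA, Pi.add_apply, Matrix.mulVec_diagonal, matB, componentwiseInput, inner_sum,
      inner_smul_right]
    congr 1
    simp only [Matrix.mulVec, dotProduct, Matrix.of_apply]
    exact Finset.sum_congr rfl fun k _ => by rw [mul_comm, real_inner_comm]
  exact (PiLp.continuousLinearEquiv 2 ℝ fun _ : Fin n => ℝ).symm.hasFDerivAt.comp_hasDerivWithinAt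
    t h

end Input

/-! ### Decay of the Lyapunov functions -/

/-- Comparison principle: a differential inequality for the upper Dini derivative yields exponential
decay. -/
theorem le_mul_exp_of_diniUpper_le {g a : ℝ → ℝ} {κ : ℝ} (hg : ContinuousOn g (Ici 0))
    (hd : ∀ t, 0 ≤ t → diniUpper g t ≤ ((a t : ℝ) : EReal))
    (ha : ∀ t, 0 ≤ t → a t ≤ -κ * g t) {t : ℝ} (ht : 0 ≤ t) : g t ≤ g 0 * Real.exp (-κ * t) := by
  have h := le_gronwallBound_of_liminf_deriv_right_le (f := g) (f' := a) (δ := g 0) (K := -κ)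
    (ε := 0) (a := 0) (b := t) (hg.mono Icc_subset_Ici_self) (fun x hx r hr => ?_) le_rfl
    (fun x hx => by simpa using ha x hx.1) t ⟨ht, le_rfl⟩
  · rwa [gronwallBound_ε0, sub_zero] at h
  · refine Eventually.frequently ?_
    have h1 : Tendsto (fun z => z - x) (𝓝[>] x) (𝓝[>] 0) := by
      refine tendsto_nhdsWithin_iff.2 ⟨?_, ?_⟩
      · have : Tendsto (fun z => z - x) (𝓝 x) (𝓝 (x - x)) :=
          (continuous_id.sub continuous_const).tendsto x
        rw [sub_self] at this
        exact this.mono_left nhdsWithin_le_nhds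
      · filter_upwards [self_mem_nhdsWithin] with z hz
        exact sub_pos.2 (mem_Ioi.1 hz)
    filter_upwards [h1.eventually (diniUpper_le_coe_iff.1 (hd x hx.1) r hr)] with z hz
    rwa [add_sub_cancel, div_eq_inv_mul] at hz

section Stability

variable {L : ℝ} {m n : ℕ} {c : X L} {e : HilbertBasis ℕ ℝ (X L)} {lam : ℕ → ℝ}
  {ℓ : ℝ} {b : Fin m → X L} {K : Matrix (Fin m) (Fin n) ℝ} {P : Matrix (Fin n) (Fin n) ℝ}

theorem continuous_modes (e : HilbertBasis ℕ ℝ (X L)) (n : ℕ) : Continuous (modes e n) := by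
  unfold modes
  fun_prop

theorem continuous_lyap (e : HilbertBasis ℕ ℝ (X L)) (P : Matrix (Fin n) (Fin n) ℝ) (γ : ℝ) :
    Continuous (lyap e P γ) := by
  have h : lyap e P γ = fun w => quad P (modes e n w) + γ * ‖w - truncation e n w‖ ^ 2 :=
    funext (lyap_eq e P γ)
  rw [h]
  have := (continuous_quad P).comp (continuous_modes e n)
  simp only [Function.comp_def] at this
  fun_prop

theorem exists_lyap_bounds (e : HilbertBasis ℕ ℝ (X L)) (hP : P.PosDef) {γ : ℝ} (hγ : 0 < γ) :
    ∃ p q : ℝ, 0 < p ∧ 0 < q ∧ ∀ w, p * ‖w‖ ^ 2 ≤ lyap e P γ w ∧ lyap e P γ w ≤ q * ‖w‖ ^ 2 := by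
  obtain ⟨p, q, hp, hq, hpq⟩ := exists_quad_bounds hP
  refine ⟨min p γ, max q γ, lt_min hp hγ, lt_max_of_lt_left hq, fun w => ?_⟩
  obtain ⟨h1, h2⟩ := hpq (modes e n w)
  rw [norm_modes] at h1 h2
  rw [lyap_eq, norm_sq_eq_truncation_add e n w, mul_add, mul_add]
  refine ⟨add_le_add (le_trans ?_ h1) ?_, add_le_add (h2.trans ?_) ?_⟩
  · exact mul_le_mul_of_nonneg_right (min_le_left _ _) (sq_nonneg _)
  · exact mul_le_mul_of_nonneg_right (min_le_right _ _) (sq_nonneg _)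
  · exact mul_le_mul_of_nonneg_right (le_max_left _ _) (sq_nonneg _)
  · exact mul_le_mul_of_nonneg_right (le_max_right _ _) (sq_nonneg _)

/-- A small weight `γ` makes the coupling of the stable modes to the input negligible against the
decay of `zᵀ P z`. -/
theorem exists_weight (hℓ : 0 < ℓ) (he : ∀ j, IsOp c (e j) (lam j • e j)) (hlam : Antitone lam)
    (hn : lam n < 0)
    (hPdecay : ∃ α₀ : ℝ, 0 < α₀ ∧
      DecaysOn (IsFinSolution ℓ (matA lam n) (matB e b n) K) (quad P) {z | quad P z ≤ 1} α₀) :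
    ∃ γ : ℝ, 0 < γ ∧ ∃ C : ℝ, 0 < C ∧
      DecaysOn (IsSolution c (componentwiseInput ℓ e b K))
        (lyap e P γ) {w | quad P (modes e n w) ≤ 1} C := by
  obtain ⟨α₀, hα₀, hdecay⟩ := hPdecay
  obtain ⟨M, hM⟩ : ∃ M : ℝ, ∀ w, ‖componentwiseInput ℓ e b K w‖ ≤ M * ‖truncation e n w‖ :=
    ⟨_, norm_componentwiseInput_le hℓ e b K⟩
  set ν : ℝ := -lam n with hν
  have hν0 : 0 < ν := by linarith
  set γ : ℝ := α₀ * ν / (2 * (M ^ 2 + 1)) with hγ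
  have hγ0 : 0 < γ := by positivity
  clear_value γ ν
  refine ⟨γ, hγ0, min (α₀ / 2) (γ * ν), by positivity, fun w hw t ht hS => ?_⟩
  have hFc := continuous_of_norm_sub_le (norm_componentwiseInput_sub_le hℓ e b K)
  have hmodal := hw.modal he
  refine (diniUpper_lyap_le e P hγ0 hw.1 (hFc.comp_continuousOn hw.1) hmodal le_rfl
    (fun j hj => hlam hj) ht).trans (EReal.coe_le_coe_iff.2 ?_)
  have hz := hdecay _ (isFinSolution_modes he hw) t ht hS
  have hder := hasDerivWithinAt_headLyap e lam P γ n (w := w)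
    (f := componentwiseInput ℓ e b K ∘ w) (s := Ici t) (t := t)
    fun j => (hmodal j t ht).mono (Ici_subset_Ici.2 ht)
  simp only [← quad_eq_headLyap] at hder
  rw [diniUpper_eq_of_hasDerivWithinAt hder, EReal.coe_le_coe_iff, norm_modes] at hz
  set a := ‖truncation e n (w t)‖
  set y := ‖w t - truncation e n (w t)‖
  have hf : inner ℝ (w t - truncation e n (w t)) ((componentwiseInput ℓ e b K ∘ w) t)
      ≤ y * (M * a) := (real_inner_le_norm _ _).trans
    (mul_le_mul_of_nonneg_left (hM (w t)) (norm_nonneg _))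
  have hw2 : ‖w t‖ ^ 2 = a ^ 2 + y ^ 2 := norm_sq_eq_truncation_add e n (w t)
  -- Young's inequality
  have hyoung : 2 * (y * (M * a)) ≤ ν * y ^ 2 + M ^ 2 * a ^ 2 / ν := by
    rw [← sub_nonneg]
    have : ν * y ^ 2 + M ^ 2 * a ^ 2 / ν - 2 * (y * (M * a)) = (ν * y - M * a) ^ 2 / ν := by
      field_simp
      ring
    rw [this]
    positivity
  have hγM : γ * (M ^ 2 * a ^ 2 / ν) ≤ α₀ / 2 * a ^ 2 := by
    have : γ * (M ^ 2 * a ^ 2 / ν) = α₀ / 2 * a ^ 2 * (M ^ 2 / (M ^ 2 + 1)) := by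
      rw [hγ]
      field_simp
    rw [this]
    exact mul_le_of_le_one_right (by positivity) ((div_le_one (by positivity)).2 (by linarith))
  have h1 : γ * (2 * (lam n * y ^ 2 +
      inner ℝ (w t - truncation e n (w t)) ((componentwiseInput ℓ e b K ∘ w) t)))
      ≤ γ * (-(ν * y ^ 2) + M ^ 2 * a ^ 2 / ν) := by
    refine mul_le_mul_of_nonneg_left ?_ hγ0.le
    have : lam n = -ν := by rw [hν, neg_neg]
    rw [this]
    linarith
  have h2 := mul_le_mul_of_nonneg_right (min_le_left (α₀ / 2) (γ * ν)) (sq_nonneg a)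
  have h3 := mul_le_mul_of_nonneg_right (min_le_right (α₀ / 2) (γ * ν)) (sq_nonneg y)
  rw [hw2]
  linarith

/-- The pointwise content of the decay along all solutions: it is read off at time zero from the
solution that starts at a truncation of `w`. -/
theorem headDeriv_le_of_decaysOn (hL : 0 < L) (hℓ : 0 < ℓ)
    (he : ∀ j, IsOp c (e j) (lam j • e j)) (hlam : Antitone lam) {γ C : ℝ} (hγ : 0 < γ)
    (hdecay : DecaysOn (IsSolution c (componentwiseInput ℓ e b K))
        (lyap e P γ) {w | quad P (modes e n w) ≤ 1} C)
    {w : X L} (hw : quad P (modes e n w) ≤ 1) {N : ℕ} (hN : n ≤ N) :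
    headDeriv e lam P γ N w (componentwiseInput ℓ e b K w) ≤ -C * ‖truncation e N w‖ ^ 2 := by
  obtain ⟨v, hv, hv0⟩ := exists_isSolution hL he hlam (componentwiseInput_zero hℓ e b K)
    (norm_componentwiseInput_sub_le hℓ e b K) (truncation e N w)
  have h := hdecay v hv 0 le_rfl (by simpa [hv0, modes_truncation e hN] using hw)
  have := headDeriv_le_of_diniUpper_le e P hγ (w := v) (f := componentwiseInput ℓ e b K ∘ v)
    (fun j => hv.modal he j 0 le_rfl) hN (by rw [hv0, truncation_truncation]) h
  rwa [Function.comp_apply, hv0, headDeriv_truncation e lam P γ hN,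
    componentwiseInput_truncation ℓ e b K hN] at this

/-- On a set where the two inputs coincide the decay carries over to the pointwise saturated
system. -/
theorem decaysOn_pointwiseInput (hL : 0 < L) (hℓ : 0 < ℓ)
    (he : ∀ j, IsOp c (e j) (lam j • e j)) (hlam : Antitone lam) (hn : lam n < 0)
    {γ C β : ℝ} (hγ : 0 < γ)
    (hdecay : DecaysOn (IsSolution c (componentwiseInput ℓ e b K))
        (lyap e P γ) {w | quad P (modes e n w) ≤ 1} C) (hβ : β ≤ 1)
    (hagree : ∀ w, quad P (modes e n w) ≤ β →
      pointwiseInput hℓ e b K w = componentwiseInput ℓ e b K w) :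
    DecaysOn (IsSolution c (pointwiseInput hℓ e b K))
      (lyap e P γ) {w | quad P (modes e n w) ≤ β} C := by
  intro w hw t ht hS
  have hFc := continuous_of_norm_sub_le (norm_pointwiseInput_sub_le hℓ e b K)
  set f : X L := pointwiseInput hℓ e b K (w t) with hf
  have hbound : ∀ N, n ≤ N → diniUpper (fun s => lyap e P γ (w s)) t ≤
      ((-C * ‖truncation e N (w t)‖ ^ 2
        + γ * (2 * inner ℝ (w t - truncation e N (w t)) f) : ℝ) : EReal) := by
    intro N hN
    refine (diniUpper_lyap_le e P hγ hw.1 (hFc.comp_continuousOn hw.1) (hw.modal he) hN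
      (fun j hj => (hlam (hN.trans hj)).trans hn.le) ht).trans (EReal.coe_le_coe_iff.2 ?_)
    have h := headDeriv_le_of_decaysOn hL hℓ he hlam hγ hdecay (le_trans hS hβ) hN
    rw [← hagree _ hS] at h
    refine add_le_add h ?_
    simp [f]
  -- the error term disappears as the number of modes tends to infinity
  have htr := tendsto_truncation e (w t)
  have hlim : Tendsto (fun N => -C * ‖truncation e N (w t)‖ ^ 2
        + γ * (2 * inner ℝ (w t - truncation e N (w t)) f)) atTop (𝓝 (-C * ‖w t‖ ^ 2)) := by
    have h1 := ((htr.norm.pow 2).const_mul (-C)).add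
      ((((tendsto_const_nhds (x := w t)).sub htr).inner
        (tendsto_const_nhds (x := f))).const_mul 2 |>.const_mul γ)
    simpa using h1
  exact ge_of_tendsto ((continuous_coe_real_ereal.tendsto _).comp hlim)
    ((eventually_ge_atTop n).mono hbound)

/-- The ellipsoid is invariant: on its boundary `zᵀ P z` decreases strictly. -/
theorem quad_le_of_quad_zero_le (hL : 0 < L) (hℓ : 0 < ℓ)
    (he : ∀ j, IsOp c (e j) (lam j • e j)) (hlam : Antitone lam) (hP : P.PosDef)
    {γ C β : ℝ} (hγ : 0 < γ) (hC : 0 < C)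
    (hdecay : DecaysOn (IsSolution c (componentwiseInput ℓ e b K))
        (lyap e P γ) {w | quad P (modes e n w) ≤ 1} C) (hβ0 : 0 < β) (hβ : β ≤ 1)
    (hagree : ∀ w, quad P (modes e n w) ≤ β →
      pointwiseInput hℓ e b K w = componentwiseInput ℓ e b K w)
    {w : ℝ → X L} (hw : IsSolution c (pointwiseInput hℓ e b K) w)
    (hw0 : quad P (modes e n (w 0)) ≤ β) {t : ℝ} (ht : 0 ≤ t) :
    quad P (modes e n (w t)) ≤ β := by
  refine image_le_of_deriv_right_lt_deriv_boundary (f := fun s => quad P (modes e n (w s)))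
    (f' := fun s => headDeriv e lam P γ n (w s) (pointwiseInput hℓ e b K (w s)))
    (B := fun _ => β) (B' := fun _ => 0) (a := 0) (b := t) ?_ ?_ hw0
    (fun x => hasDerivAt_const x β) ?_ ⟨ht, le_rfl⟩
  · exact ((continuous_quad P).comp (continuous_modes e n)).comp_continuousOn
      (hw.1.mono Icc_subset_Ici_self)
  · intro s hs
    simp only [quad_eq_headLyap e P γ]
    exact hasDerivWithinAt_headLyap e lam P γ n (w := w)
      (f := fun s => pointwiseInput hℓ e b K (w s))
      fun j => (hw.modal he j s hs.1).mono (Ici_subset_Ici.2 hs.1)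
  · intro s hs hq
    have h := headDeriv_le_of_decaysOn hL hℓ he hlam hγ hdecay (hq.le.trans hβ) le_rfl
    rw [← hagree _ hq.le] at h
    refine h.trans_lt ?_
    obtain ⟨_, q, _, hq0, hpq⟩ := exists_quad_bounds hP
    have h1 := (hpq (modes e n (w s))).2
    rw [hq, norm_modes] at h1
    have h2 : 0 < ‖truncation e n (w s)‖ ^ 2 := by
      by_contra h3
      nlinarith
    nlinarith

/-- A coercive quadratic Lyapunov function that decays on an invariant neighbourhood of zero makes
this neighbourhood a region of attraction. -/
theorem isRegionOfAttraction_of_decaysOn {F : X L → X L} (hF0 : F 0 = 0) {V : X L → ℝ}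
    {S : Set (X L)} {p q C : ℝ} (hp : 0 < p) (hq : 0 < q) (hC : 0 < C) (hV : Continuous V)
    (hpq : ∀ w, p * ‖w‖ ^ 2 ≤ V w ∧ V w ≤ q * ‖w‖ ^ 2)
    (hdecay : DecaysOn (IsSolution c F) V S C) (hS : S ∈ 𝓝 0)
    (hex : ∀ w₀, ∃ w, IsSolution c F w ∧ w 0 = w₀)
    (hinv : ∀ w, IsSolution c F w → w 0 ∈ S → ∀ t : ℝ, 0 ≤ t → w t ∈ S) :
    IsRegionOfAttraction (IsSolution c F) S := by
  have hexp : ∀ w, IsSolution c F w → w 0 ∈ S → ∀ t : ℝ, 0 ≤ t →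
      p * ‖w t‖ ^ 2 ≤ q * ‖w 0‖ ^ 2 * Real.exp (-(C / q) * t) := by
    intro w hw h0 t ht
    have h := le_mul_exp_of_diniUpper_le (g := fun s => V (w s)) (κ := C / q)
      (hV.comp_continuousOn hw.1) (fun s hs => hdecay w hw s hs (hinv w hw h0 s hs))
      (fun s _ => ?_) ht
    · exact ((hpq (w t)).1.trans h).trans
        (mul_le_mul_of_nonneg_right (hpq (w 0)).2 (Real.exp_pos _).le)
    · have h1 := mul_le_mul_of_nonneg_left (hpq (w s)).2 (div_pos hC hq).le
      have h2 : C / q * (q * ‖w s‖ ^ 2) = C * ‖w s‖ ^ 2 := by field_simp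
      linarith
  refine ⟨isSolution_zero hF0, fun ε hε => ?_, mem_interior_iff_mem_nhds.2 hS,
    fun w₀ _ => hex w₀, fun w hw h0 => ?_, hinv⟩
  · obtain ⟨η, hη, hηS⟩ := Metric.mem_nhds_iff.1 hS
    refine ⟨min η (ε * √(p / q)), by positivity, fun w hw hw0 t ht => ?_⟩
    have h := hexp w hw (hηS (by simpa using hw0.trans_le (min_le_left _ _))) t ht
    have h1 : Real.exp (-(C / q) * t) ≤ 1 := Real.exp_le_one_iff.2 (by
      have : 0 ≤ C / q * t := by positivity
      linarith)
    have h2 : ‖w 0‖ ^ 2 < (ε * √(p / q)) ^ 2 :=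
      pow_lt_pow_left₀ (hw0.trans_le (min_le_right _ _)) (norm_nonneg _) two_ne_zero
    rw [mul_pow, Real.sq_sqrt (by positivity)] at h2
    have h3 : q * ‖w 0‖ ^ 2 < p * ε ^ 2 := by
      calc q * ‖w 0‖ ^ 2 < q * (ε ^ 2 * (p / q)) := mul_lt_mul_of_pos_left h2 hq
        _ = p * ε ^ 2 := by field_simp
    have h4 : p * ‖w t‖ ^ 2 < p * ε ^ 2 :=
      (h.trans (mul_le_of_le_one_right (by positivity) h1)).trans_lt h3
    exact lt_of_pow_lt_pow_left₀ 2 hε.le (lt_of_mul_lt_mul_left h4 hp.le)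
  · have h1 : Tendsto (fun t => q * ‖w 0‖ ^ 2 / p * Real.exp (-(C / q) * t)) atTop (𝓝 0) := by
      have : Tendsto (fun t => -(C / q) * t) atTop atBot :=
        tendsto_id.const_mul_atTop_of_neg (by linarith [div_pos hC hq])
      simpa using (Real.tendsto_exp_atBot.comp this).const_mul (q * ‖w 0‖ ^ 2 / p)
    have h2 : Tendsto (fun t => ‖w t‖ ^ 2) atTop (𝓝 0) := by
      refine squeeze_zero' (Eventually.of_forall fun t => sq_nonneg _) ?_ h1
      filter_upwards [eventually_ge_atTop 0] with t ht
      rw [div_mul_eq_mul_div, le_div_iff₀ hp, mul_comm]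
      exact hexp w hw h0 t ht
    rw [tendsto_zero_iff_norm_tendsto_zero]
    have h3 := h2.sqrt
    simpa using h3

end Stability

end HeatSat

end

theorem mainTheorem5
    {L : ℝ} (hL : 0 < L) {ℓ : ℝ} (hℓ : 0 < ℓ)
    -- the reaction coefficient and the essentially bounded input profiles
    (c : HeatSat.X L) {m : ℕ} (b : Fin m → HeatSat.X L)
    (hb : ∀ k, MemLp (b k : ℝ → ℝ) ⊤ (HeatSat.leb L))
    -- the eigenfunctions and eigenvalues of `A`, in decreasing order
    (e : HilbertBasis ℕ ℝ (HeatSat.X L)) (lam : ℕ → ℝ)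
    (he : ∀ j, HeatSat.IsOp c (e j) (lam j • e j)) (hlam : Antitone lam)
    -- `n` is the number of nonnegative eigenvalues
    (n : ℕ) (hn : ∀ j, 0 ≤ lam j ↔ j < n)
    (K : Matrix (Fin m) (Fin n) ℝ)
    (hK : HeatSat.IsHurwitz (HeatSat.matA lam n + HeatSat.matB e b n * K))
    (P : Matrix (Fin n) (Fin n) ℝ) (hP : P.PosDef)
    (hPdecay : ∃ α₀ : ℝ, 0 < α₀ ∧
      HeatSat.DecaysOn (HeatSat.IsFinSolution ℓ (HeatSat.matA lam n) (HeatSat.matB e b n) K)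
        (HeatSat.quad P) {z | HeatSat.quad P z ≤ 1} α₀) :
    -- weights `γ` as in the Lyapunov function of the componentwise saturated system exist
    (∃ γ : ℝ, 0 < γ ∧ ∃ C : ℝ, 0 < C ∧
      HeatSat.DecaysOn (HeatSat.IsSolution c (HeatSat.componentwiseInput ℓ e b K))
        (HeatSat.lyap e P γ) {w | HeatSat.quad P (HeatSat.modes e n w) ≤ 1} C) ∧
    -- and for each such weight the claim holds for the pointwise saturated system
    ∀ γ : ℝ, 0 < γ →
      (∃ C : ℝ, 0 < C ∧
        HeatSat.DecaysOn (HeatSat.IsSolution c (HeatSat.componentwiseInput ℓ e b K))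
          (HeatSat.lyap e P γ) {w | HeatSat.quad P (HeatSat.modes e n w) ≤ 1} C) →
      ∃ α β : ℝ, 0 < α ∧ 0 < β ∧
        HeatSat.DecaysOn (HeatSat.IsSolution c (HeatSat.pointwiseInput hℓ e b K))
          (HeatSat.lyap e P γ) {w | HeatSat.quad P (HeatSat.modes e n w) ≤ β} (α / 2) ∧
        HeatSat.IsRegionOfAttraction
          (HeatSat.IsSolution c (HeatSat.pointwiseInput hℓ e b K))
          {w | HeatSat.quad P (HeatSat.modes e n w) ≤ β} := by
  have hneg : lam n < 0 := not_le.1 fun h => lt_irrefl n ((hn n).1 h)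
  refine ⟨HeatSat.exists_weight hℓ he hlam hneg hPdecay, fun γ hγ ⟨C, hC, hdecay⟩ => ?_⟩
  obtain ⟨δ, hδ, hagree⟩ := HeatSat.exists_pointwiseInput_eq hℓ e b hb K
  obtain ⟨p, _, hp, _, hpq⟩ := HeatSat.exists_quad_bounds hP
  -- on the ellipsoid of level `p δ²` one has `‖z‖ ≤ δ`
  set β : ℝ := min 1 (p * δ ^ 2) with hβ
  have hβ0 : 0 < β := by positivity
  have hβ1 : β ≤ 1 := min_le_left _ _
  have hagree' : ∀ w, HeatSat.quad P (HeatSat.modes e n w) ≤ β →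
      HeatSat.pointwiseInput hℓ e b K w = HeatSat.componentwiseInput ℓ e b K w := by
    intro w hw
    refine hagree w ?_
    have h1 := ((hpq (HeatSat.modes e n w)).1.trans hw).trans (min_le_right _ _)
    rw [HeatSat.norm_modes] at h1
    exact le_of_sq_le_sq (le_of_mul_le_mul_left h1 hp) hδ.le
  have hdec := HeatSat.decaysOn_pointwiseInput hL hℓ he hlam hneg hγ hdecay hβ1 hagree'
  refine ⟨2 * C, β, by positivity, hβ0, by rwa [mul_div_cancel_left₀ _ two_ne_zero], ?_⟩
  obtain ⟨p', q', hp', hq', hV⟩ := HeatSat.exists_lyap_bounds e hP hγ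
  refine HeatSat.isRegionOfAttraction_of_decaysOn (HeatSat.pointwiseInput_zero hℓ e b K) hp' hq' hC
    (HeatSat.continuous_lyap e P γ) hV hdec ?_
    (HeatSat.exists_isSolution hL he hlam (HeatSat.pointwiseInput_zero hℓ e b K)
      (HeatSat.norm_pointwiseInput_sub_le hℓ e b K))
    fun w hw h0 t ht => HeatSat.quad_le_of_quad_zero_le hL hℓ he hlam hP hγ hC hdecay hβ0 hβ1
      hagree' hw h0 ht
  have hc : Continuous fun w => HeatSat.quad P (HeatSat.modes e n w) :=
    (HeatSat.continuous_quad P).comp (HeatSat.continuous_modes e n)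
  have h0 : HeatSat.quad P (HeatSat.modes e n 0) < β := by
    have : HeatSat.modes e n 0 = 0 := by ext j; simp [HeatSat.modes]
    simpa [this, HeatSat.quad] using hβ0
  exact (hc.continuousAt.eventually (gt_mem_nhds h0)).mono fun w hw => le_of_lt hw
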